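/- Let $(n,m)\in\{(2,2),(3,4),(5,8)\}$ and $\hbar>0$. Let $L^2(S^n)$ be taken with respect to the normalized surface measure $d\Omega$ of the unit sphere $S^n\subset\mathbb R^{n+1}$, with inner product $\langle\phi,\psi\rangle=\int_{S^n}\phi\,\overline{\psi}\,d\Omega$. For vectors put $\mathbf a\cdot\mathbf b=\sum_j a_j\overline{b_j}$. Define $\rho=\rho_{(n,m)}:\mathbb C^m\to\mathbb C^{n+1}$ by - $(n,m)=(2,2)$: $\rho(z)=\big(\tfrac12(z_2^2-z_1^2),\ \tfrac i2(z_1^2+z_2^2),\ z_1z_2\big)$; - $(n,m)=(3,4)$: $\rho(z)=\big(z_1z_3+z_2z_4,\ i(z_1z_3-z_2z_4),\ i(z_1z_4+z_2z_3),\ z_1z_4-z_2z_3\big)$; - $(n,m)=(5,8)$: $\rho(z)=\big(i(-z_1z_6+z_3z_8+z_2z_5-z_4z_7),\ z_1z_6+z_3z_8+z_2z_5+z_4z_7,\ z_2z_6+z_3z_7-z_1z_5-z_4z_8,\ i(-z_1z_5+z_4z_8-z_2z_6+z_3z_7),\ i(-z_1z_8-z_2z_7-z_3z_6-z_4z_5),\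 z_1z_8+z_2z_7-z_3z_6-z_4z_5\big)$. For $z\in\mathbb C^m$ let $\Phi_{\rho(z)}\in L^2(S^n)$ be the coherent state $$\Phi_{\rho(z)}(x)=\sum_{\ell=0}^\infty\frac{\sqrt{2\ell+n-1}}{\ell!\,\sqrt{n-1}}\Big(\frac{x\cdot\rho(z)}{\hbar}\Big)^{\ell},\qquad x\in S^n,$$ and for $\psi\in L^2(S^n)$ put $$B_{S^n}\psi(z)=\int_{S^n}\Big(\sum_{\ell=0}^\infty\frac{\sqrt{2\ell+n-1}}{\ell!\,\sqrt{n-1}}\Big(\frac{\rho(z)\cdot x}{\hbar}\Big)^{\ell}\Big)\psi(x)\,d\Omega(x)=\langle\psi,\Phi_{\rho(z)}\rangle .$$ Let $d\mu(z)=(\pi\hbar)^{-m}e^{-|z|^2/\hbar}\,dz\,d\bar z$, where $|z|^2=z\cdot z$ and $dz\,d\bar z$ is the Lebesgue measure on $\mathbb C^m$, and let $\mathcal B_m$ be the Bargmann space of entire functions on $\mathbb C^m$ that are square integrable for $\mu$, with the $L^2(\mu)$ norm. Let $\mathcal F_m\subset\mathcal B_m$ be - for $m=2$: the closed subspace generated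 by the monomials of even degree; - for $m=4$: the kernel of $v_1\partial_1+v_2\partial_2-v_3\partial_3-v_4\partial_4$; - for $m=8$: the intersection of the kernels of $\sum_{j=1}^4 v_j\partial_j-\sum_{j=5}^8v_j\partial_j$, $\ v_7\partial_1-v_8\partial_2+v_5\partial_3-v_6\partial_4-v_3\partial_5+v_4\partial_6-v_1\partial_7+v_2\partial_8$ and $\ v_7\partial_1-v_8\partial_2+v_5\partial_3-v_6\partial_4+v_3\partial_5-v_4\partial_6+v_1\partial_7-v_2\partial_8$. Then $B_{S^n}$ is a unitary transformation of $L^2(S^n)$ onto $\mathcal F_m$, and the following holds for every bounded linear operator $A:L^2(S^n)\to L^2(S^n)$. Put $\mathfrak K_A(z,w)=\langle A\Phi_{\rho(w)},\Phi_{\rho(z)}\rangle$ for $z,w\in\mathbb C^m$, and let $A^\sharp$ be the integral operator on $\mathcal F_m$ with kernel $\mathfrak K_A$ with respect to $\mu$, $$A^\sharp f(z)=\int_{\mathbb C^m}\mathfrak K_A(z,w)\,f(w)\,d\mu(w).$$ Then for all $f\in\mathcal F_m$ and $z\in\mathbb C^m$ the integrand is $\mu$-integrable and $$A^\sharp f(z)=\big(B_{S^n}\,A\,B_{S^n}^{-1}f\big)(z).$$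 -/

import Mathlib

open MeasureTheory Set
open scoped ComplexConjugate Nat

noncomputable section

/-! ### The unit sphere and its normalized surface measure -/

/-- The unit sphere `S^n` in `ℝ^(n+1)`. -/
abbrev USphere (n : ℕ) : Type := Metric.sphere (0 : EuclideanSpace ℝ (Fin (n + 1))) 1

/-- The surface measure of `S^n`, normalized to total mass one. -/
def sphereMeasure (n : ℕ) : Measure (USphere n) :=
  ((volume : Measure (EuclideanSpace ℝ (Fin (n + 1)))).toSphere univ)⁻¹ •
    (volume : Measure (EuclideanSpace ℝ (Fin (n + 1)))).toSphere

instance instIsProbabilityMeasureSphere (n : ℕ) : IsProbabilityMeasure (sphereMeasure n) := by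
  constructor
  rw [sphereMeasure, Measure.smul_apply, smul_eq_mul]
  refine ENNReal.inv_mul_cancel ?_ (measure_ne_top _ _)
  rw [Ne, Measure.measure_univ_eq_zero]
  exact Measure.toSphere_ne_zero _

/-- The Hilbert space `L²(S^n)`. In Mathlib `inner ℂ φ ψ` is conjugate-linear in `φ` and linear
in `ψ`, so `∫ φ conj ψ` is `inner ℂ ψ φ`. -/
abbrev L2Sphere (n : ℕ) : Type := Lp ℂ 2 (sphereMeasure n)

/-! ### The power series of the kernel, and the coherent states -/

/-- The coefficient `√(2ℓ+n-1) / (ℓ! √(n-1))`. -/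
def kernelCoeff (n l : ℕ) : ℝ :=
  Real.sqrt (2 * (l : ℝ) + (n : ℝ) - 1) / ((l ! : ℝ) * Real.sqrt ((n : ℝ) - 1))

/-- The entire function `t ↦ ∑ₗ √(2ℓ+n-1) / (ℓ! √(n-1)) t^ℓ`. -/
def kernelSeries (n : ℕ) (t : ℂ) : ℂ := ∑' l : ℕ, (kernelCoeff n l : ℂ) * t ^ l

theorem kernelCoeff_nonneg (n l : ℕ) : 0 ≤ kernelCoeff n l := by
  unfold kernelCoeff; positivity

theorem summable_kernelCoeff_mul_pow (n : ℕ) (R : ℝ) (hR : 0 ≤ R) :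
    Summable fun l : ℕ => kernelCoeff n l * R ^ l := by
  have h := (Real.summable_pow_div_factorial (2 * R)).mul_left
    (((n : ℝ) + 3) * (Real.sqrt ((n : ℝ) - 1))⁻¹)
  refine Summable.of_nonneg_of_le (fun l => mul_nonneg (kernelCoeff_nonneg n l) (pow_nonneg hR l))
    (fun l => ?_) h
  have h2 : (l : ℝ) ≤ 2 ^ l := by exact_mod_cast (Nat.lt_two_pow_self (n := l)).le
  have h1 : (1 : ℝ) ≤ 2 ^ l := one_le_pow₀ (by norm_num)
  have hs : Real.sqrt (2 * (l : ℝ) + (n : ℝ) - 1) ≤ ((n : ℝ) + 3) * 2 ^ l := by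
    have hn : (0 : ℝ) ≤ n := Nat.cast_nonneg n
    have hl : (0 : ℝ) ≤ l := Nat.cast_nonneg l
    rw [Real.sqrt_le_iff]
    constructor
    · positivity
    · have : 2 * (l : ℝ) + n + 1 ≤ ((n : ℝ) + 3) * 2 ^ l := by nlinarith
      nlinarith
  calc kernelCoeff n l * R ^ l
      = Real.sqrt (2 * (l : ℝ) + (n : ℝ) - 1) *
          ((Real.sqrt ((n : ℝ) - 1))⁻¹ * (R ^ l / (l ! : ℝ))) := by
        unfold kernelCoeff; rw [div_eq_mul_inv, mul_inv]; ring
    _ ≤ (((n : ℝ) + 3) * 2 ^ l) * ((Real.sqrt ((n : ℝ) - 1))⁻¹ * (R ^ l / (l ! : ℝ))) :=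
        mul_le_mul_of_nonneg_right hs (by positivity)
    _ = _ := by rw [mul_pow]; ring

theorem continuous_kernelSeries (n : ℕ) : Continuous (kernelSeries n) := by
  rw [continuous_iff_continuousAt]
  intro t
  have hc : ContinuousOn (kernelSeries n) (Metric.ball 0 (‖t‖ + 1)) := by
    refine continuousOn_tsum (fun l => by fun_prop)
      (summable_kernelCoeff_mul_pow n (‖t‖ + 1) (by positivity)) (fun l s hs => ?_)
    rw [norm_mul, norm_pow, Complex.norm_real, Real.norm_of_nonneg (kernelCoeff_nonneg n l)]
    refine mul_le_mul_of_nonneg_left (pow_le_pow_left₀ (norm_nonneg _) ?_ l)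
      (kernelCoeff_nonneg n l)
    exact (mem_ball_zero_iff.1 hs).le
  exact hc.continuousAt (Metric.isOpen_ball.mem_nhds (by simp))

/-- The coherent state `Φ_α(x) = ∑ₗ √(2ℓ+n-1) / (ℓ! √(n-1)) ((x · α) / ħ)^ℓ`, where
`x · α = ∑ᵢ xᵢ conj αᵢ`, as a continuous function on the sphere. -/
def coherentFun (n : ℕ) (ħ : ℝ) (α : Fin (n + 1) → ℂ) : C(USphere n, ℂ) where
  toFun x := kernelSeries n ((∑ i, ((x.1 i : ℝ) : ℂ) * conj (α i)) / (ħ : ℂ))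
  continuous_toFun := by
    refine (continuous_kernelSeries n).comp (Continuous.div_const ?_ _)
    fun_prop

/-- The coherent state `Φ_α` as an element of `L²(S^n)`. -/
def coherentState (n : ℕ) (ħ : ℝ) (α : Fin (n + 1) → ℂ) : L2Sphere n :=
  ContinuousMap.toLp 2 (sphereMeasure n) ℂ (coherentFun n ħ α)

/-! ### The Bargmann space -/

/-- The Gaussian measure `(πħ)^(-m) exp(-|z|²/ħ) dz dz̄` on `ℂ^m`, where `|z|² = ∑ |z_j|²` and
`dz dz̄` is the Lebesgue measure. -/
def gaussMeasure (m : ℕ) (ħ : ℝ) : Measure (Fin m → ℂ) :=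
  (volume : Measure (Fin m → ℂ)).withDensity fun z =>
    ENNReal.ofReal (1 / (Real.pi * ħ) ^ m * Real.exp (-(∑ j, ‖z j‖ ^ 2) / ħ))

/-- Entire functions on `ℂ^m` that are square integrable for the Gaussian measure. -/
def bargmannSubmodule (m : ℕ) (ħ : ℝ) : Submodule ℂ ((Fin m → ℂ) → ℂ) where
  carrier := {f | Differentiable ℂ f ∧ MemLp f 2 (gaussMeasure m ħ)}
  zero_mem' := ⟨differentiable_const 0, MemLp.zero⟩
  add_mem' hf hg := ⟨hf.1.add hg.1, hf.2.add hg.2⟩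
  smul_mem' c _ hf := ⟨hf.1.const_smul c, hf.2.const_smul c⟩

/-- The Bargmann space. It is a type of its own, not a subtype of the function space, since its
topology is that of the `L²` norm and not that of pointwise convergence. -/
def Bargmann (m : ℕ) (ħ : ℝ) : Type := bargmannSubmodule m ħ

namespace Bargmann

variable {m : ℕ} {ħ : ℝ}

instance instAddCommGroup : AddCommGroup (Bargmann m ħ) :=
  inferInstanceAs (AddCommGroup (bargmannSubmodule m ħ))

instance instModule : Module ℂ (Bargmann m ħ) :=
  inferInstanceAs (Module ℂ (bargmannSubmodule m ħ))

instance instCoeFun : CoeFun (Bargmann m ħ) (fun _ => (Fin m → ℂ) → ℂ) :=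
  ⟨fun f => f.1⟩

theorem differentiable (f : Bargmann m ħ) : Differentiable ℂ (f : (Fin m → ℂ) → ℂ) := f.2.1

theorem memLp (f : Bargmann m ħ) : MemLp (f : (Fin m → ℂ) → ℂ) 2 (gaussMeasure m ħ) := f.2.2

@[simp] theorem zero_apply (z : Fin m → ℂ) : (0 : Bargmann m ħ) z = 0 := rfl

@[simp] theorem add_apply (f g : Bargmann m ħ) (z : Fin m → ℂ) : (f + g) z = f z + g z := rfl

@[simp] theorem smul_apply (c : ℂ) (f : Bargmann m ħ) (z : Fin m → ℂ) : (c • f) z = c * f z := rfl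

/-- The inclusion of the Bargmann space into `L²` of the Gaussian measure. -/
def toL2 (m : ℕ) (ħ : ℝ) : Bargmann m ħ →ₗ[ℂ] Lp ℂ 2 (gaussMeasure m ħ) where
  toFun f := f.memLp.toLp _
  map_add' f g := MemLp.toLp_add f.memLp g.memLp
  map_smul' c f := MemLp.toLp_const_smul c f.memLp

/-- The norm `‖f‖ = (∫ |f|² dμ)^(1/2)`, inherited from `L²` of the Gaussian measure. -/
instance instSeminormedAddCommGroup : SeminormedAddCommGroup (Bargmann m ħ) :=
  SeminormedAddCommGroup.induced _ _ (toL2 m ħ)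

instance instNormedSpace : NormedSpace ℂ (Bargmann m ħ) :=
  NormedSpace.induced ℂ _ _ (toL2 m ħ)

end Bargmann

/-- The operator `f ↦ ∑ⱼ aⱼ(v) ∂f/∂vⱼ`. -/
def firstOrderOp {m : ℕ} (a : (Fin m → ℂ) → (Fin m → ℂ)) (f : (Fin m → ℂ) → ℂ)
    (v : Fin m → ℂ) : ℂ :=
  ∑ j, a v j * fderiv ℂ f v (Pi.single j 1)

/-- The kernel in the Bargmann space of the operator `∑ⱼ aⱼ(v) ∂/∂vⱼ` with domain
`{f | ∑ⱼ aⱼ ∂ⱼf is in the Bargmann space}`. (A function that the operator sends to zero is in the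
domain.) -/
def opKernel {m : ℕ} (ħ : ℝ) (a : (Fin m → ℂ) → (Fin m → ℂ)) : Submodule ℂ (Bargmann m ħ) where
  carrier := {f | ∀ v, firstOrderOp a f v = 0}
  zero_mem' v := by
    change firstOrderOp a (fun _ => (0 : ℂ)) v = 0
    simp [firstOrderOp]
  add_mem' := by
    intro f g hf hg v
    have h : firstOrderOp a (f + g : Bargmann m ħ) v
        = firstOrderOp a f v + firstOrderOp a g v := by
      change firstOrderOp a ((f : (Fin m → ℂ) → ℂ) + (g : (Fin m → ℂ) → ℂ)) v = _
      simp only [firstOrderOp]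
      rw [fderiv_add (f.differentiable v) (g.differentiable v), ← Finset.sum_add_distrib]
      simp [mul_add]
    rw [h, hf v, hg v, add_zero]
  smul_mem' := by
    intro c f hf v
    have h : firstOrderOp a (c • f : Bargmann m ħ) v = c * firstOrderOp a f v := by
      change firstOrderOp a (c • (f : (Fin m → ℂ) → ℂ)) v = _
      simp only [firstOrderOp]
      rw [fderiv_const_smul (f.differentiable v), Finset.mul_sum]
      simp [mul_left_comm]
    rw [h, hf v, mul_zero]

/-! ### The three cases `(n, m) = (2, 2), (3, 4), (5, 8)` -/

inductive SphereCase : Type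
  | case22
  | case34
  | case58

namespace SphereCase

/-- The dimension `n` of the sphere. -/
def n : SphereCase → ℕ
  | case22 => 2
  | case34 => 3
  | case58 => 5

/-- The dimension `m` of the complex space. -/
def m : SphereCase → ℕ
  | case22 => 2
  | case34 => 4
  | case58 => 8

end SphereCase

def rho22 (z : Fin 2 → ℂ) : Fin 3 → ℂ :=
  ![(1 / 2) * (z 1 ^ 2 - z 0 ^ 2),
    (Complex.I / 2) * (z 0 ^ 2 + z 1 ^ 2),
    z 0 * z 1]

def rho34 (z : Fin 4 → ℂ) : Fin 4 → ℂ :=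
  ![z 0 * z 2 + z 1 * z 3,
    Complex.I * (z 0 * z 2 - z 1 * z 3),
    Complex.I * (z 0 * z 3 + z 1 * z 2),
    z 0 * z 3 - z 1 * z 2]

def rho58 (z : Fin 8 → ℂ) : Fin 6 → ℂ :=
  ![Complex.I * (-(z 0 * z 5) + z 2 * z 7 + z 1 * z 4 - z 3 * z 6),
    z 0 * z 5 + z 2 * z 7 + z 1 * z 4 + z 3 * z 6,
    z 1 * z 5 + z 2 * z 6 - z 0 * z 4 - z 3 * z 7,
    Complex.I * (-(z 0 * z 4) + z 3 * z 7 - z 1 * z 5 + z 2 * z 6),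
    Complex.I * (-(z 0 * z 7) - z 1 * z 6 - z 2 * z 5 - z 3 * z 4),
    z 0 * z 7 + z 1 * z 6 - z 2 * z 5 - z 3 * z 4]

/-- The closed subspace of the Bargmann space on `ℂ²` generated by the monomials of even degree. -/
def F2 (ħ : ℝ) : Submodule ℂ (Bargmann 2 ħ) :=
  (Submodule.span ℂ {f : Bargmann 2 ħ |
    ∃ k : Fin 2 → ℕ, Even (∑ j, k j) ∧ ∀ z, f z = ∏ j, z j ^ k j}).topologicalClosure

/-- The kernel of `v₁∂₁ + v₂∂₂ - v₃∂₃ - v₄∂₄` in the Bargmann space on `ℂ⁴`. -/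
def F4 (ħ : ℝ) : Submodule ℂ (Bargmann 4 ħ) :=
  opKernel ħ fun v => ![v 0, v 1, -v 2, -v 3]

/-- The intersection of the kernels of
`v₁∂₁ + v₂∂₂ + v₃∂₃ + v₄∂₄ - v₅∂₅ - v₆∂₆ - v₇∂₇ - v₈∂₈`,
`v₇∂₁ - v₈∂₂ + v₅∂₃ - v₆∂₄ - v₃∂₅ + v₄∂₆ - v₁∂₇ + v₂∂₈` and
`v₇∂₁ - v₈∂₂ + v₅∂₃ - v₆∂₄ + v₃∂₅ - v₄∂₆ + v₁∂₇ - v₂∂₈` in the Bargmann space on `ℂ⁸`. -/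
def F8 (ħ : ℝ) : Submodule ℂ (Bargmann 8 ħ) :=
  opKernel ħ (fun v => ![v 0, v 1, v 2, v 3, -v 4, -v 5, -v 6, -v 7]) ⊓
  opKernel ħ (fun v => ![v 6, -v 7, v 4, -v 5, -v 2, v 3, -v 0, v 1]) ⊓
  opKernel ħ (fun v => ![v 6, -v 7, v 4, -v 5, v 2, -v 3, v 0, -v 1])

namespace SphereCase

/-- The map `ρ_(n,m) : ℂ^m → ℂ^(n+1)`. -/
def rho : (c : SphereCase) → (Fin c.m → ℂ) → (Fin (c.n + 1) → ℂ)
  | case22 => rho22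
  | case34 => rho34
  | case58 => rho58

/-- The subspace `F_m` of the Bargmann space on `ℂ^m`. -/
def F : (c : SphereCase) → (ħ : ℝ) → Submodule ℂ (Bargmann c.m ħ)
  | case22 => F2
  | case34 => F4
  | case58 => F8

/-- The coherent state `Φ_{ρ(z)}` in `L²(S^n)`. -/
def Phi (c : SphereCase) (ħ : ℝ) (z : Fin c.m → ℂ) : L2Sphere c.n :=
  coherentState c.n ħ (c.rho z)

/-- The transformation `B_{S^n}`:
`B ψ(z) = ∫ (∑ₗ √(2ℓ+n-1) / (ℓ! √(n-1)) ((ρ(z) · x) / ħ)^ℓ) ψ(x) dΩ(x)`. -/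
def transform (c : SphereCase) (ħ : ℝ) (ψ : L2Sphere c.n) (z : Fin c.m → ℂ) : ℂ :=
  ∫ x : USphere c.n,
    kernelSeries c.n ((∑ i, c.rho z i * ((x.1 i : ℝ) : ℂ)) / (ħ : ℂ)) * ψ x ∂(sphereMeasure c.n)

/-- The kernel `K_A(z, w) = ⟨A Φ_{ρ(w)}, Φ_{ρ(z)}⟩`, where `⟨φ, ψ⟩ = ∫ φ conj ψ dΩ`. -/
def kernelK (c : SphereCase) (ħ : ℝ) (A : L2Sphere c.n →L[ℂ] L2Sphere c.n)
    (z w : Fin c.m → ℂ) : ℂ :=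
  inner ℂ (c.Phi ħ z) (A (c.Phi ħ w))

/-- The integral operator with kernel `K_A` for the Gaussian measure:
`A^♯ f(z) = ∫ K_A(z, w) f(w) dμ(w)`. -/
def sharp (c : SphereCase) (ħ : ℝ) (A : L2Sphere c.n →L[ℂ] L2Sphere c.n)
    (f : (Fin c.m → ℂ) → ℂ) (z : Fin c.m → ℂ) : ℂ :=
  ∫ w, c.kernelK ħ A z w * f w ∂(gaussMeasure c.m ħ)

end SphereCase

end

/-! Put `k = n - 2`, so `k = 0, 1, 3` and `S^k` is the group of unit real, complex or quaternionic
scalars. The map `ρ` is quadratic, maps `ℂ^m` onto the cone of isotropic vectors `α ⬝ᵥ α = 0`, and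
is constant on the orbits of an action of `S^k` on `ℂ^m`. `ConeModel` records these facts with one
algebraic identity: for the maps `G i` that generate the action, `∑ᵢ (G i z · w)² = 2 ρ(z) · ρ(w)`.
The heart of the proof is a comparison of two series. On isotropic vectors the moments of `S^n` are
diagonal in the degree, and the coefficients of `Φ` are such that `⟨Φ_{ρ(w)}, Φ_{ρ(z)}⟩` has the
moment denominators of `S^(n-2)` (`kernelCoeff_sq`, `hasSum_inner_coherentState`). With the identity
above it equals the average over `v ∈ S^k` of the Bargmann kernel `exp(vz · w / ħ)`
(`ConeModel.inner_coherentState`). Since the exponential kernel reproduces entire functions in the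
Bargmann space, the coherent state kernel reproduces the `S^k`-invariant ones
(`ConeModel.reproducing`). This makes the transform isometric on the span of the coherent states,
and Fatou's lemma with density extends this to `L²(S^n)`. Density rests on Laplace's integral:
averaging powers of the isotropic forms `x · (y + iu)` over unit `u ⊥ y` gives a polynomial of exact
degree `l` in `x · y`, so all powers and exponentials of real linear forms are reached, and
Stone–Weierstrass applies. Surjectivity onto the invariant functions is again the reproducing
property, the preimage being supplied by the adjoint. It remains to see that `F_m` is the space of
invariant functions. For `m = 4, 8` the unit imaginary combinations of the generators square to
`-1`, so each group element lies on a curve `cos θ + sin θ Y`, and invariance is annihilation by the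
generators; for `m = 2` invariance is evenness. The statement on `A^♯` follows because its integrand
is the product of the transform of `ψ = B⁻¹f` with the conjugate of the transform of `A* Φ_{ρ(z)}`.
-/

noncomputable section

/-! ### Moments of the normalized surface measure -/

/-- The complex bilinear pairing `x · c = ∑ᵢ xᵢ cᵢ` of a real and a complex vector. -/
def pairing {N : ℕ} (x : EuclideanSpace ℝ (Fin N)) (c : Fin N → ℂ) : ℂ :=
  ∑ i, ((x i : ℝ) : ℂ) * c i

section Pairing

variable {N : ℕ}

@[fun_prop]
theorem continuous_pairing (c : Fin N → ℂ) : Continuous fun x => pairing x c := by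
  unfold pairing; fun_prop

theorem pairing_smul_left (r : ℝ) (x : EuclideanSpace ℝ (Fin N)) (c : Fin N → ℂ) :
    pairing (r • x) c = r * pairing x c := by
  simp [pairing, Finset.mul_sum, mul_assoc]

theorem pairing_smul_right (x : EuclideanSpace ℝ (Fin N)) (a : ℂ) (c : Fin N → ℂ) :
    pairing x (a • c) = a * pairing x c := by
  simp [pairing, Finset.mul_sum, mul_left_comm]

theorem pairing_add_right (x : EuclideanSpace ℝ (Fin N)) (b c : Fin N → ℂ) :
    pairing x (b + c) = pairing x b + pairing x c := by
  simp [pairing, mul_add, Finset.sum_add_distrib]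

theorem pairing_add_single (x : EuclideanSpace ℝ (Fin N)) (t : ℝ) (i : Fin N) (c : Fin N → ℂ) :
    pairing (x + t • EuclideanSpace.single i 1) c = pairing x c + t * c i := by
  simp only [pairing, PiLp.add_apply, PiLp.smul_apply, smul_eq_mul, PiLp.single_apply,
    Complex.ofReal_add, add_mul, Finset.sum_add_distrib]
  congr 1
  rw [Finset.sum_eq_single i (fun j _ hj => by simp [hj]) (by simp)]
  simp

theorem norm_pairing_le (x : EuclideanSpace ℝ (Fin N)) (c : Fin N → ℂ) :
    ‖pairing x c‖ ≤ (∑ i, ‖c i‖) * ‖x‖ := by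
  rw [pairing, Finset.sum_mul]
  refine norm_sum_le_of_le _ fun i _ => ?_
  rw [norm_mul, Complex.norm_real, mul_comm]
  exact mul_le_mul_of_nonneg_left (PiLp.norm_apply_le x i) (norm_nonneg _)

/-- The Gaussian weight. -/
def gaussWeight (x : EuclideanSpace ℝ (Fin N)) : ℂ := (Real.exp (-(1 / 2) * ‖x‖ ^ 2) : ℝ)

@[fun_prop]
theorem continuous_gaussWeight : Continuous (gaussWeight (N := N)) := by
  unfold gaussWeight; fun_prop

end Pairing

/-! ### Gaussian integrals of polynomials and integration by parts. -/

theorem integrable_norm_pow_mul_exp (n l : ℕ) :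
    Integrable fun x : EuclideanSpace ℝ (Fin (n + 1)) =>
      ‖x‖ ^ l * Real.exp (-(1 / 2) * ‖x‖ ^ 2) := by
  rw [integrable_fun_norm_addHaar volume
    (f := fun r : ℝ => r ^ l * Real.exp (-(1 / 2) * r ^ 2))]
  have h := integrableOn_rpow_mul_exp_neg_mul_sq (b := 1 / 2) (by norm_num)
    (s := ((n + l : ℕ) : ℝ)) (by have := Nat.cast_nonneg (α := ℝ) (n + l); linarith)
  refine h.congr_fun (fun r _ => ?_) measurableSet_Ioi
  simp only [Real.rpow_natCast, smul_eq_mul, finrank_euclideanSpace_fin, Nat.add_sub_cancel]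
  ring

theorem integrable_mul_gaussWeight {n : ℕ} (l : ℕ) {g : EuclideanSpace ℝ (Fin (n + 1)) → ℂ}
    (hg : Continuous g) (C : ℝ) (hC : ∀ x, ‖g x‖ ≤ C * ‖x‖ ^ l) :
    Integrable fun x => g x * gaussWeight x := by
  refine ((integrable_norm_pow_mul_exp n l).const_mul C).mono'
    (by fun_prop) (Filter.Eventually.of_forall fun x => ?_)
  rw [norm_mul, gaussWeight, Complex.norm_real, Real.norm_of_nonneg (Real.exp_pos _).le, ← mul_assoc]
  exact mul_le_mul_of_nonneg_right (hC x) (Real.exp_pos _).le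

theorem integrable_pairing_pow_mul {n : ℕ} (a b : Fin (n + 1) → ℂ) (l k : ℕ) :
    Integrable fun x => (pairing x a ^ l * pairing x b ^ k) * gaussWeight x := by
  refine integrable_mul_gaussWeight (l + k) (by fun_prop)
    ((∑ i, ‖a i‖) ^ l * (∑ i, ‖b i‖) ^ k) fun x => ?_
  rw [norm_mul, norm_pow, norm_pow, pow_add, mul_mul_mul_comm, ← mul_pow, ← mul_pow]
  exact mul_le_mul (pow_le_pow_left₀ (norm_nonneg _) (norm_pairing_le x a) l)
    (pow_le_pow_left₀ (norm_nonneg _) (norm_pairing_le x b) k) (by positivity) (by positivity)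

theorem integrable_coord_mul_pairing_pow_mul {n : ℕ} (a b : Fin (n + 1) → ℂ) (l k : ℕ)
    (i : Fin (n + 1)) :
    Integrable fun x => (pairing x a ^ l * pairing x b ^ k) * (-(x i : ℂ) * gaussWeight x) := by
  have := integrable_mul_gaussWeight (n := n) (l + k + 1)
    (g := fun x => (pairing x a ^ l * pairing x b ^ k) * -(x i : ℂ)) (by fun_prop)
    ((∑ i, ‖a i‖) ^ l * (∑ i, ‖b i‖) ^ k) fun x => ?_
  · simpa only [mul_assoc] using this
  rw [norm_mul, norm_mul, norm_pow, norm_pow, pow_succ, pow_add, ← mul_assoc, mul_mul_mul_comm,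
    ← mul_pow, ← mul_pow, norm_neg, Complex.norm_real]
  exact mul_le_mul (mul_le_mul (pow_le_pow_left₀ (norm_nonneg _) (norm_pairing_le x a) l)
    (pow_le_pow_left₀ (norm_nonneg _) (norm_pairing_le x b) k) (by positivity) (by positivity))
    (PiLp.norm_apply_le x i) (norm_nonneg _) (by positivity)

theorem hasLineDerivAt_pairing_pow {N : ℕ} (a : Fin N → ℂ) (l : ℕ) (i : Fin N)
    (x : EuclideanSpace ℝ (Fin N)) :
    HasLineDerivAt ℝ (fun x => pairing x a ^ l) (l * pairing x a ^ (l - 1) * a i) x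
      (EuclideanSpace.single i 1) := by
  unfold HasLineDerivAt
  simp only [pairing_add_single]
  have h1 : HasDerivAt (fun t : ℝ => pairing x a + (t : ℂ) * a i) (a i) 0 := by
    simpa using ((Complex.ofRealCLM.hasDerivAt (x := (0 : ℝ))).mul_const (a i)).const_add
      (pairing x a)
  have h2 := h1.fun_pow l
  simp only [Complex.ofReal_zero, zero_mul, add_zero] at h2
  exact h2

theorem hasLineDerivAt_gaussWeight {N : ℕ} (i : Fin N) (x : EuclideanSpace ℝ (Fin N)) :
    HasLineDerivAt ℝ gaussWeight (-(x i : ℂ) * gaussWeight x) x (EuclideanSpace.single i 1) := by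
  unfold HasLineDerivAt gaussWeight
  have h : ∀ t : ℝ, ‖x + t • EuclideanSpace.single i (1 : ℝ)‖ ^ 2
      = ‖x‖ ^ 2 + 2 * t * x i + t ^ 2 := by
    intro t
    rw [norm_add_sq_real, real_inner_smul_right, EuclideanSpace.inner_single_right, norm_smul,
      PiLp.norm_single]
    simp; ring
  simp only [h]
  have h1 : HasDerivAt (fun t : ℝ => -(1 / 2) * (‖x‖ ^ 2 + 2 * t * x i + t ^ 2)) (-(x i)) 0 := by
    have h2 := ((((hasDerivAt_id' (0 : ℝ)).const_mul 2).mul_const (x i)).const_add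
      (‖x‖ ^ 2)).fun_add ((hasDerivAt_id' (0 : ℝ)).fun_pow 2)
    refine (h2.const_mul (-(1 / 2))).congr_deriv ?_
    norm_num
    ring
  refine h1.exp.ofReal_comp.congr_deriv ?_
  push_cast
  simp only [mul_zero, zero_mul, add_zero, ne_eq, OfNat.ofNat_ne_zero, not_false_eq_true, zero_pow]
  ring_nf

/-- Multiplication of the weight by `x i` is minus its derivative in direction `i`, so integrating
by parts differentiates the polynomial. The truncated exponents at `l = 0` and `k = 0` do no harm,
their coefficient being zero. -/
theorem integral_coord_mul_pairing_pow {n : ℕ} (a b : Fin (n + 1) → ℂ) (l k : ℕ)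
    (i : Fin (n + 1)) :
    ∫ x, (x i : ℂ) * ((pairing x a ^ l * pairing x b ^ k) * gaussWeight x) =
      l * a i * (∫ x, (pairing x a ^ (l - 1) * pairing x b ^ k) * gaussWeight x) +
      k * b i * ∫ x, (pairing x a ^ l * pairing x b ^ (k - 1)) * gaussWeight x := by
  have hd : ∀ x : EuclideanSpace ℝ (Fin (n + 1)),
      HasLineDerivAt ℝ (fun x => pairing x a ^ l * pairing x b ^ k)
        (l * a i * (pairing x a ^ (l - 1) * pairing x b ^ k) +
          k * b i * (pairing x a ^ l * pairing x b ^ (k - 1))) x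
        (EuclideanSpace.single i 1) := by
    intro x
    have h := HasDerivAt.fun_mul (hasLineDerivAt_pairing_pow a l i x)
      (hasLineDerivAt_pairing_pow b k i x)
    refine HasDerivAt.congr_deriv h ?_
    simp only [zero_smul, add_zero]
    ring
  have hi1 := (integrable_pairing_pow_mul a b (l - 1) k).const_mul (l * a i)
  have hi2 := (integrable_pairing_pow_mul a b l (k - 1)).const_mul (k * b i)
  have key := integral_bilinear_hasLineDerivAt_right_eq_neg_left_of_integrable (μ := volume)
    (B := ContinuousLinearMap.mul ℝ ℂ) (v := EuclideanSpace.single i (1 : ℝ))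
    (f := fun x => pairing x a ^ l * pairing x b ^ k) (g := gaussWeight)
    (f' := fun x => l * a i * (pairing x a ^ (l - 1) * pairing x b ^ k) +
          k * b i * (pairing x a ^ l * pairing x b ^ (k - 1)))
    (g' := fun x => -(x i : ℂ) * gaussWeight x)
    (by
      refine (hi1.add hi2).congr (Filter.Eventually.of_forall fun x => ?_)
      simp only [ContinuousLinearMap.mul_apply', Pi.add_apply]
      ring)
    (by simpa only [ContinuousLinearMap.mul_apply'] using
      integrable_coord_mul_pairing_pow_mul a b l k i)
    (by simpa only [ContinuousLinearMap.mul_apply'] using integrable_pairing_pow_mul a b l k)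
    (fun x _ => hd x) (fun x _ => hasLineDerivAt_gaussWeight i x)
  simp only [ContinuousLinearMap.mul_apply'] at key
  rw [← integral_const_mul, ← integral_const_mul, ← integral_add hi1 hi2, ← neg_inj]
  simp only [add_mul, mul_assoc] at key ⊢
  rw [← key, ← integral_neg]
  congr 1 with x
  ring

/-- Gaussian integration by parts. -/
theorem integral_pairing_mul_pairing_pow {n : ℕ} (c a b : Fin (n + 1) → ℂ) (l k : ℕ) :
    ∫ x, pairing x c * ((pairing x a ^ l * pairing x b ^ k) * gaussWeight x) =
      l * (c ⬝ᵥ a) * (∫ x, (pairing x a ^ (l - 1) * pairing x b ^ k) * gaussWeight x) +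
      k * (c ⬝ᵥ b) * ∫ x, (pairing x a ^ l * pairing x b ^ (k - 1)) * gaussWeight x := by
  have h : ∀ x : EuclideanSpace ℝ (Fin (n + 1)),
      pairing x c * ((pairing x a ^ l * pairing x b ^ k) * gaussWeight x) =
      ∑ i, c i * ((x i : ℂ) * ((pairing x a ^ l * pairing x b ^ k) * gaussWeight x)) := by
    intro x
    rw [pairing, Finset.sum_mul]
    exact Finset.sum_congr rfl fun i _ => by ring
  simp only [h]
  rw [integral_finsetSum _ fun i _ => ?_]
  · simp only [integral_const_mul, integral_coord_mul_pairing_pow, dotProduct, mul_add,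
      Finset.sum_add_distrib, Finset.mul_sum, Finset.sum_mul]
    congr 1 <;> exact Finset.sum_congr rfl fun i _ => by ring
  · refine Integrable.const_mul ?_ _
    convert (integrable_coord_mul_pairing_pow_mul a b l k i).neg using 2 with x
    simp; ring

/-- The radial Gaussian integral. -/
def radialIntegral (n N : ℕ) : ℝ :=
  ∫ y in Ioi (0 : ℝ), y ^ n * (y ^ N * Real.exp (-(1 / 2) * y ^ 2))

theorem radialIntegral_eq (n N : ℕ) : radialIntegral n N =
    (1 / 2 : ℝ) ^ (-(((n + N : ℕ) : ℝ) + 1) / 2) * (1 / 2) *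
      Real.Gamma ((((n + N : ℕ) : ℝ) + 1) / 2) := by
  have h := integral_rpow_mul_exp_neg_mul_rpow (p := 2) (q := ((n + N : ℕ) : ℝ)) (b := 1 / 2)
    (by norm_num) (by have := Nat.cast_nonneg (α := ℝ) (n + N); linarith) (by norm_num)
  rw [radialIntegral, ← h]
  refine setIntegral_congr_fun measurableSet_Ioi fun y _ => ?_
  simp only [Real.rpow_natCast, Real.rpow_two]
  ring

theorem radialIntegral_pos (n N : ℕ) : 0 < radialIntegral n N := by
  rw [radialIntegral_eq]
  have : 0 < Real.Gamma ((((n + N : ℕ) : ℝ) + 1) / 2) := Real.Gamma_pos_of_pos (by positivity)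
  positivity

/-- The functional equation of the Gamma function. This ratio is the only information on the radial
integrals, besides positivity, that the spherical moments require. -/
theorem radialIntegral_add_two (n N : ℕ) :
    radialIntegral n (N + 2) = (n + N + 1) * radialIntegral n N := by
  rw [radialIntegral_eq, radialIntegral_eq]
  have h1 : (((n + (N + 2) : ℕ) : ℝ) + 1) / 2 = (((n + N : ℕ) : ℝ) + 1) / 2 + 1 := by
    push_cast; ring
  have h2 : -(((n + (N + 2) : ℕ) : ℝ) + 1) / 2 = -(((n + N : ℕ) : ℝ) + 1) / 2 - 1 := by
    push_cast; ring
  rw [h1, h2, Real.Gamma_add_one (by positivity), Real.rpow_sub_one (by norm_num)]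
  push_cast
  ring

/-- Integration of a homogeneous function in polar coordinates. -/
theorem integral_mul_gaussWeight_of_homogeneous {n : ℕ} (N : ℕ)
    (g : EuclideanSpace ℝ (Fin (n + 1)) → ℂ)
    (hg : ∀ r : ℝ, 0 < r → ∀ x, g (r • x) = (r : ℂ) ^ N * g x) :
    ∫ x, g x * gaussWeight x =
      ((volume : Measure (EuclideanSpace ℝ (Fin (n + 1)))).toSphere.real univ : ℂ) *
        radialIntegral n N * ∫ x : USphere n, g x ∂(sphereMeasure n) := by
  set μ := (volume : Measure (EuclideanSpace ℝ (Fin (n + 1)))) with hμ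
  have hs : μ.toSphere.real univ ≠ 0 := by
    rw [Measure.real, ENNReal.toReal_ne_zero]
    refine ⟨?_, measure_ne_top _ _⟩
    rw [Ne, Measure.measure_univ_eq_zero]
    exact Measure.toSphere_ne_zero _
  have h1 : ∫ x, g x * gaussWeight x ∂μ =
      ∫ x : ({(0)}ᶜ : Set (EuclideanSpace ℝ (Fin (n + 1)))), g x * gaussWeight x.1
        ∂(μ.comap (↑)) := by
    rw [integral_subtype_comap (measurableSet_singleton _).compl fun x => g x * gaussWeight x,
      restrict_compl_singleton]
  have h2 := μ.measurePreserving_homeomorphUnitSphereProd.integral_comp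
        (Homeomorph.measurableEmbedding _)
        (fun p : USphere n × Ioi (0 : ℝ) => g p.1 *
          (((p.2 : ℝ) ^ N * Real.exp (-(1 / 2) * (p.2 : ℝ) ^ 2) : ℝ) : ℂ))
  have h3 : ∀ x : ({(0)}ᶜ : Set (EuclideanSpace ℝ (Fin (n + 1)))),
      g ((homeomorphUnitSphereProd _ x).1 : EuclideanSpace ℝ (Fin (n + 1))) *
        ((((homeomorphUnitSphereProd _ x).2 : ℝ) ^ N *
          Real.exp (-(1 / 2) * ((homeomorphUnitSphereProd _ x).2 : ℝ) ^ 2) : ℝ) : ℂ) =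
      g x * gaussWeight x.1 := by
    intro x
    have hx : 0 < ‖(x : EuclideanSpace ℝ (Fin (n + 1)))‖ := norm_pos_iff.2 x.2
    have := hg ‖(x : EuclideanSpace ℝ (Fin (n + 1)))‖ hx
      (homeomorphUnitSphereProd _ x).1
    rw [homeomorphUnitSphereProd_apply_fst_coe, smul_inv_smul₀ hx.ne'] at this
    rw [homeomorphUnitSphereProd_apply_fst_coe, homeomorphUnitSphereProd_apply_snd_coe, this,
      gaussWeight]
    push_cast
    ring
  simp only [h3] at h2
  rw [h1, h2, integral_prod_mul (fun x : USphere n => g x)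
    (fun r : Ioi (0 : ℝ) => (((r : ℝ) ^ N * Real.exp (-(1 / 2) * (r : ℝ) ^ 2) : ℝ) : ℂ))]
  have h4 : ∫ r : Ioi (0 : ℝ), (((r : ℝ) ^ N * Real.exp (-(1 / 2) * (r : ℝ) ^ 2) : ℝ) : ℂ)
      ∂(Measure.volumeIoiPow (Module.finrank ℝ (EuclideanSpace ℝ (Fin (n + 1))) - 1)) =
      (radialIntegral n N : ℂ) := by
    rw [integral_complex_ofReal]
    congr 1
    simp only [Measure.volumeIoiPow, ENNReal.ofReal]
    rw [integral_withDensity_eq_integral_smul (by fun_prop), finrank_euclideanSpace_fin,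
      Nat.add_sub_cancel, integral_subtype_comap measurableSet_Ioi fun a =>
        Real.toNNReal (a ^ n) • (a ^ N * Real.exp (-(1 / 2) * a ^ 2)), radialIntegral]
    refine setIntegral_congr_fun measurableSet_Ioi fun x hx => ?_
    rw [NNReal.smul_def, Real.coe_toNNReal _ (pow_nonneg hx.out.le _), smul_eq_mul]
  have h5 : ∫ x : USphere n, g x ∂(sphereMeasure n) =
      (μ.toSphere.real univ : ℂ)⁻¹ * ∫ x : USphere n, g x ∂μ.toSphere := by
    rw [sphereMeasure, integral_smul_measure, ENNReal.toReal_inv, ← Measure.real,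
      Complex.real_smul, Complex.ofReal_inv]
  rw [h4, h5]
  have hs' : (μ.toSphere.real univ : ℂ) ≠ 0 := by exact_mod_cast hs
  field_simp

/-- Transfers a Gaussian recurrence to the sphere: in polar coordinates the two sides have radial
factors in the ratio `n + 1 + N`, and the area of the sphere cancels. -/
theorem sphereMoment_step {n : ℕ} (N : ℕ) {g h : EuclideanSpace ℝ (Fin (n + 1)) → ℂ} (a : ℂ)
    (hg : ∀ r : ℝ, 0 < r → ∀ x, g (r • x) = (r : ℂ) ^ (N + 2) * g x)
    (hh : ∀ r : ℝ, 0 < r → ∀ x, h (r • x) = (r : ℂ) ^ N * h x)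
    (hgh : ∫ x, g x * gaussWeight x = a * ∫ x, h x * gaussWeight x) :
    ((n : ℂ) + 1 + N) * ∫ x : USphere n, g x ∂(sphereMeasure n) =
      a * ∫ x : USphere n, h x ∂(sphereMeasure n) := by
  rw [integral_mul_gaussWeight_of_homogeneous (N + 2) g hg,
    integral_mul_gaussWeight_of_homogeneous N h hh, radialIntegral_add_two] at hgh
  have h1 : (radialIntegral n N : ℂ) ≠ 0 := by exact_mod_cast (radialIntegral_pos n N).ne'
  have h2 : ((volume : Measure (EuclideanSpace ℝ (Fin (n + 1)))).toSphere.real univ : ℂ) ≠ 0 := by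
    rw [Complex.ofReal_ne_zero, Measure.real, ENNReal.toReal_ne_zero]
    refine ⟨?_, measure_ne_top _ _⟩
    rw [Ne, Measure.measure_univ_eq_zero]
    exact Measure.toSphere_ne_zero _
  refine mul_left_cancel₀ (mul_ne_zero h2 h1) ?_
  push_cast at hgh
  linear_combination hgh

theorem sphereMoment_eq_zero {n : ℕ} (N : ℕ) {g : EuclideanSpace ℝ (Fin (n + 1)) → ℂ}
    (hg : ∀ r : ℝ, 0 < r → ∀ x, g (r • x) = (r : ℂ) ^ N * g x)
    (h0 : ∫ x, g x * gaussWeight x = 0) : ∫ x : USphere n, g x ∂(sphereMeasure n) = 0 := by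
  rw [integral_mul_gaussWeight_of_homogeneous N g hg] at h0
  have h1 : (radialIntegral n N : ℂ) ≠ 0 := by exact_mod_cast (radialIntegral_pos n N).ne'
  have h2 : ((volume : Measure (EuclideanSpace ℝ (Fin (n + 1)))).toSphere.real univ : ℂ) ≠ 0 := by
    rw [Complex.ofReal_ne_zero, Measure.real, ENNReal.toReal_ne_zero]
    refine ⟨?_, measure_ne_top _ _⟩
    rw [Ne, Measure.measure_univ_eq_zero]
    exact Measure.toSphere_ne_zero _
  exact (mul_eq_zero.1 h0).resolve_left (mul_ne_zero h2 h1)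

/-- The product `N (N + 2) ⋯ (N + 2 l - 2)`. -/
def stepTwoFactorial (N l : ℕ) : ℝ := ∏ i ∈ Finset.range l, ((N : ℝ) + 2 * i)

theorem stepTwoFactorial_pos {N : ℕ} (hN : 0 < N) (l : ℕ) : 0 < stepTwoFactorial N l := by
  refine Finset.prod_pos fun i _ => ?_
  have : (0 : ℝ) < N := by exact_mod_cast hN
  positivity

theorem stepTwoFactorial_zero (N : ℕ) : stepTwoFactorial N 0 = 1 := by simp [stepTwoFactorial]

theorem stepTwoFactorial_succ (N l : ℕ) :
    stepTwoFactorial N (l + 1) = stepTwoFactorial N l * (N + 2 * l) := by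
  simp [stepTwoFactorial, Finset.prod_range_succ]

theorem integral_pairing_pow_even {n : ℕ} (c : Fin (n + 1) → ℂ) (l : ℕ) :
    ∫ x : USphere n, pairing x.1 c ^ (2 * l) ∂(sphereMeasure n) =
      ((2 * l)! : ℂ) * (c ⬝ᵥ c) ^ l / (2 ^ l * (l ! : ℂ) * (stepTwoFactorial (n + 1) l : ℂ)) := by
  induction l with
  | zero => simp [stepTwoFactorial_zero]
  | succ l ih =>
    have h := sphereMoment_step (n := n) (2 * l) (g := fun x => pairing x c ^ (2 * l + 2))
      (h := fun x => pairing x c ^ (2 * l)) ((2 * l + 1) * (c ⬝ᵥ c))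
      (fun r _ x => by rw [pairing_smul_left, mul_pow])
      (fun r _ x => by rw [pairing_smul_left, mul_pow]) (by
        have := integral_pairing_mul_pairing_pow c c c (2 * l + 1) 0
        simp only [pow_zero, mul_one, Nat.cast_zero, zero_mul, add_zero, Nat.add_sub_cancel] at this
        push_cast at this
        rw [← this]
        congr 1 with x
        ring)
    rw [ih] at h
    have hp := stepTwoFactorial_pos (Nat.succ_pos n) l
    have hp' : (stepTwoFactorial (n + 1) l : ℂ) ≠ 0 := by exact_mod_cast hp.ne'
    have hl : ((l ! : ℕ) : ℂ) ≠ 0 := by exact_mod_cast Nat.factorial_ne_zero l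
    have hl1 : (l : ℂ) + 1 ≠ 0 := by exact_mod_cast Nat.succ_ne_zero l
    have hn : (n : ℂ) + 1 + 2 * l ≠ 0 := by
      have : n + 1 + 2 * l ≠ 0 := by omega
      exact_mod_cast this
    rw [show 2 * (l + 1) = 2 * l + 2 by ring, stepTwoFactorial_succ, Nat.factorial_succ l,
      show (2 * l + 2)! = (2 * l + 2) * ((2 * l + 1) * (2 * l)!) by
        rw [Nat.factorial_succ, Nat.factorial_succ]]
    push_cast at h ⊢
    refine mul_left_cancel₀ hn (h.trans ?_)
    field_simp
    ring

theorem integral_pairing_pow_odd {n : ℕ} (c : Fin (n + 1) → ℂ) (l : ℕ) :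
    ∫ x : USphere n, pairing x.1 c ^ (2 * l + 1) ∂(sphereMeasure n) = 0 := by
  refine sphereMoment_eq_zero (n := n) (2 * l + 1) (g := fun x => pairing x c ^ (2 * l + 1))
    (fun r _ x => by rw [pairing_smul_left, mul_pow]) ?_
  induction l with
  | zero =>
    have := integral_pairing_mul_pairing_pow c c c 0 0
    simpa using this
  | succ l ih =>
    have := integral_pairing_mul_pairing_pow c c c (2 * (l + 1)) 0
    simp only [pow_zero, mul_one, Nat.cast_zero, zero_mul, add_zero] at this
    rw [show 2 * (l + 1) - 1 = 2 * l + 1 by omega, ih, mul_zero] at this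
    rw [← this]
    congr 1 with x
    ring

/-- In Gaussian integration by parts only contractions of an `a` with a `b` survive, since isotropy
kills the others. Each step lowers both exponents by one; unequal exponents thus lead to a pure
power of one isotropic form, whose integral is zero. -/
theorem integral_pairing_pow_mul_pairing_pow {n : ℕ} {a b : Fin (n + 1) → ℂ}
    (ha : a ⬝ᵥ a = 0) (hb : b ⬝ᵥ b = 0) (l k : ℕ) :
    ∫ x : USphere n, pairing x.1 a ^ l * pairing x.1 b ^ k ∂(sphereMeasure n) =
      if l = k then (l ! : ℂ) * (a ⬝ᵥ b) ^ l / (stepTwoFactorial (n + 1) l : ℂ) else 0 := by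
  have hom : ∀ (l k : ℕ) (r : ℝ), 0 < r → ∀ x : EuclideanSpace ℝ (Fin (n + 1)),
      pairing (r • x) a ^ l * pairing (r • x) b ^ k =
        (r : ℂ) ^ (l + k) * (pairing x a ^ l * pairing x b ^ k) := by
    intro l k r _ x
    simp only [pairing_smul_left, mul_pow, pow_add]
    ring
  induction l generalizing k with
  | zero =>
    cases k with
    | zero => simp [stepTwoFactorial_zero]
    | succ k =>
      rw [if_neg (Nat.succ_ne_zero k).symm]
      refine sphereMoment_eq_zero (n := n) (0 + (k + 1))
        (g := fun x => pairing x a ^ 0 * pairing x b ^ (k + 1)) (hom 0 (k + 1)) ?_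
      have := integral_pairing_mul_pairing_pow b a b 0 k
      simp only [pow_zero, one_mul, Nat.cast_zero, zero_mul, zero_add, hb, mul_zero] at this
      rw [← this]
      congr 1 with x
      ring
  | succ l ih =>
    cases k with
    | zero =>
      rw [if_neg (Nat.succ_ne_zero l)]
      refine sphereMoment_eq_zero (n := n) (l + 1 + 0)
        (g := fun x => pairing x a ^ (l + 1) * pairing x b ^ 0) (hom (l + 1) 0) ?_
      have := integral_pairing_mul_pairing_pow a a b l 0
      simp only [pow_zero, mul_one, Nat.cast_zero, zero_mul, add_zero, ha, mul_zero] at this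
      rw [← this]
      congr 1 with x
      ring
    | succ k =>
      have h := sphereMoment_step (n := n) (l + k)
        (g := fun x => pairing x a ^ (l + 1) * pairing x b ^ (k + 1))
        (h := fun x => pairing x a ^ l * pairing x b ^ k) ((l + 1) * (a ⬝ᵥ b))
        (fun r hr x => by
          rw [hom (l + 1) (k + 1) r hr x]; congr 2; omega) (hom l k) (by
          have := integral_pairing_mul_pairing_pow b a b (l + 1) k
          simp only [hb, mul_zero, zero_mul, add_zero, Nat.add_sub_cancel] at this
          push_cast at this
          rw [dotProduct_comm b a] at this
          rw [← this]
          congr 1 with x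
          ring)
      rw [ih] at h
      have hn : (n : ℂ) + 1 + (l + k : ℕ) ≠ 0 := by
        have : n + 1 + (l + k) ≠ 0 := by omega
        exact_mod_cast this
      refine mul_left_cancel₀ hn (h.trans ?_)
      by_cases hlk : l = k
      · subst hlk
        have hp := stepTwoFactorial_pos (Nat.succ_pos n) l
        have hp' : (stepTwoFactorial (n + 1) l : ℂ) ≠ 0 := by exact_mod_cast hp.ne'
        have hn2 : (n : ℂ) + 1 + l * 2 ≠ 0 := by
          have : n + 1 + l * 2 ≠ 0 := by omega
          exact_mod_cast this
        rw [if_pos rfl, if_pos rfl, stepTwoFactorial_succ, Nat.factorial_succ]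
        push_cast
        rw [mul_comm (2 : ℂ) (l : ℂ)]
        field_simp
        ring
      · simp [hlk]

/-! ### The Gaussian measure and the reproducing kernel of the Bargmann space -/

/-- The density of the Gaussian measure. -/
def gaussDensity (m : ℕ) (ħ : ℝ) (z : Fin m → ℂ) : ℝ :=
  1 / (Real.pi * ħ) ^ m * Real.exp (-(∑ j, ‖z j‖ ^ 2) / ħ)

section Gauss

variable {m : ℕ} {ħ : ℝ}

@[fun_prop]
theorem continuous_gaussDensity : Continuous (gaussDensity m ħ) := by
  unfold gaussDensity; fun_prop

theorem gaussDensity_nonneg (hħ : 0 < ħ) (z : Fin m → ℂ) : 0 ≤ gaussDensity m ħ z := by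
  have := Real.pi_pos
  unfold gaussDensity; positivity

theorem gaussMeasure_eq_withDensity : gaussMeasure m ħ =
    volume.withDensity fun z => ENNReal.ofReal (gaussDensity m ħ z) := rfl

theorem integral_gaussMeasure (hħ : 0 < ħ) (f : (Fin m → ℂ) → ℂ) :
    ∫ z, f z ∂(gaussMeasure m ħ) = ∫ z, (gaussDensity m ħ z : ℂ) * f z := by
  rw [gaussMeasure_eq_withDensity, integral_withDensity_eq_integral_toReal_smul
    (continuous_gaussDensity (m := m) (ħ := ħ)).measurable.ennreal_ofReal
    (Filter.Eventually.of_forall fun z => ENNReal.ofReal_lt_top)]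
  refine integral_congr_ae (Filter.Eventually.of_forall fun z => ?_)
  simp only [ENNReal.toReal_ofReal (gaussDensity_nonneg hħ z), Complex.real_smul]

theorem integrable_gaussMeasure_iff {E : Type*} [NormedAddCommGroup E] [NormedSpace ℝ E]
    (hħ : 0 < ħ) (f : (Fin m → ℂ) → E) :
    Integrable f (gaussMeasure m ħ) ↔ Integrable fun z => gaussDensity m ħ z • f z := by
  rw [gaussMeasure_eq_withDensity, integrable_withDensity_iff_integrable_smul'
    (continuous_gaussDensity (m := m) (ħ := ħ)).measurable.ennreal_ofReal
    (Filter.Eventually.of_forall fun z => ENNReal.ofReal_lt_top)]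
  refine integrable_congr (Filter.Eventually.of_forall fun z => ?_)
  simp only [ENNReal.toReal_ofReal (gaussDensity_nonneg hħ z)]

/-! ### Functions of exponential growth under the Gaussian measure. -/

theorem integrable_exp_neg_sq_add_norm (hħ : 0 < ħ) (D : ℝ) :
    Integrable fun u : ℂ => Real.exp (-‖u‖ ^ 2 / ħ + D * ‖u‖) := by
  -- Half of the Gaussian absorbs the linear term: `D ‖u‖ ≤ ‖u‖² / (2ħ) + D² ħ / 2`.
  have h := (GaussianFourier.integrable_cexp_neg_mul_sq_norm_add (V := ℂ)
    (b := ((1 / (2 * ħ) : ℝ) : ℂ)) (by rw [Complex.ofReal_re]; positivity) 0 0).norm.const_mul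
    (Real.exp (D ^ 2 * ħ / 2))
  refine h.mono' (by fun_prop) (Filter.Eventually.of_forall fun u => ?_)
  rw [Real.norm_of_nonneg (Real.exp_pos _).le, Complex.norm_exp, ← Real.exp_add]
  refine Real.exp_le_exp.2 ?_
  have h1 : (-((1 / (2 * ħ) : ℝ) : ℂ) * (‖u‖ : ℂ) ^ 2 + 0 * (inner ℝ (0 : ℂ) u : ℂ)).re =
      -(1 / (2 * ħ)) * ‖u‖ ^ 2 := by
    rw [zero_mul, add_zero, ← Complex.ofReal_pow, ← Complex.ofReal_neg, ← Complex.ofReal_mul,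
      Complex.ofReal_re]
  rw [h1]
  have h2 : D ^ 2 * ħ / 2 + -(1 / (2 * ħ)) * ‖u‖ ^ 2 - (-‖u‖ ^ 2 / ħ + D * ‖u‖) =
      (D * ħ - ‖u‖) ^ 2 / (2 * ħ) := by
    field_simp; ring
  have h3 : 0 ≤ (D * ħ - ‖u‖) ^ 2 / (2 * ħ) := by positivity
  linarith

theorem gaussDensity_mul_exp (z : Fin m → ℂ) (D : ℝ) :
    gaussDensity m ħ z * Real.exp (D * ∑ j, ‖z j‖) =
      1 / (Real.pi * ħ) ^ m * ∏ j, Real.exp (-‖z j‖ ^ 2 / ħ + D * ‖z j‖) := by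
  rw [gaussDensity, mul_assoc, ← Real.exp_add, ← Real.exp_sum, Finset.sum_add_distrib,
    Finset.mul_sum, neg_div, Finset.sum_div, ← Finset.sum_neg_distrib]
  simp only [neg_div]

theorem integrable_exp_gaussMeasure (hħ : 0 < ħ) (D : ℝ) :
    Integrable (fun z : Fin m → ℂ => Real.exp (D * ∑ j, ‖z j‖)) (gaussMeasure m ħ) := by
  rw [integrable_gaussMeasure_iff hħ]
  simp only [smul_eq_mul, gaussDensity_mul_exp]
  exact (Integrable.fintype_prod fun _ => integrable_exp_neg_sq_add_norm hħ D).const_mul _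

theorem memLp_exp_gaussMeasure (hħ : 0 < ħ) (D : ℝ) :
    MemLp (fun z : Fin m → ℂ => Real.exp (D * ∑ j, ‖z j‖)) 2 (gaussMeasure m ħ) := by
  rw [memLp_two_iff_integrable_sq (Continuous.aestronglyMeasurable (by fun_prop))]
  refine (integrable_exp_gaussMeasure hħ (2 * D)).congr (Filter.Eventually.of_forall fun z => ?_)
  simp only
  rw [← Real.exp_nat_mul]
  congr 1
  push_cast
  ring

theorem integral_gaussDensity (hħ : 0 < ħ) : ∫ z, gaussDensity m ħ z = 1 := by
  have h : ∀ z, gaussDensity m ħ z =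
      1 / (Real.pi * ħ) ^ m * ∏ j, Real.exp (-‖z j‖ ^ 2 / ħ) := by
    intro z
    simpa using gaussDensity_mul_exp (ħ := ħ) z 0
  simp only [h]
  rw [integral_const_mul, integral_fintype_prod_volume_eq_pow (fun u : ℂ =>
    Real.exp (-‖u‖ ^ 2 / ħ)), Fintype.card_fin]
  have h1 := Complex.integral_exp_neg_mul_rpow (p := 2) (b := 1 / ħ) (by norm_num) (by positivity)
  have h2 : ∀ u : ℂ, Real.exp (-(1 / ħ) * ‖u‖ ^ (2 : ℝ)) = Real.exp (-‖u‖ ^ 2 / ħ) := by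
    intro u; rw [Real.rpow_two]; congr 1; ring
  simp only [h2] at h1
  rw [h1]
  have h3 : (1 / ħ : ℝ) ^ (-2 / 2 : ℝ) = ħ := by
    rw [show (-2 / 2 : ℝ) = -1 by norm_num, Real.rpow_neg_one, one_div, inv_inv]
  have h4 : Real.Gamma (2 / 2 + 1) = 1 := by norm_num
  rw [h3, h4, mul_one]
  have := Real.pi_pos
  field_simp

theorem isProbabilityMeasure_gaussMeasure (hħ : 0 < ħ) :
    IsProbabilityMeasure (gaussMeasure m ħ) := by
  constructor
  have h0 := (integrable_gaussMeasure_iff (m := m) hħ fun _ => (1 : ℝ)).1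
    (by simpa using integrable_exp_gaussMeasure (m := m) hħ 0)
  have h := ofReal_integral_eq_lintegral_ofReal (μ := volume) (f := gaussDensity m ħ)
    (by simpa using h0) (Filter.Eventually.of_forall fun z => gaussDensity_nonneg hħ z)
  rw [gaussMeasure_eq_withDensity, withDensity_apply _ MeasurableSet.univ, Measure.restrict_univ]
  rw [← h, integral_gaussDensity hħ, ENNReal.ofReal_one]

/-! ### Rotation invariance, the mean value property and the reproducing kernel. -/

theorem volume_preserving_smul_of_norm_eq_one {c : ℂ} (hc : ‖c‖ = 1) :
    MeasurePreserving (fun w : Fin m → ℂ => c • w) := by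
  have h1 : MeasurePreserving (fun u : ℂ => c * u) :=
    (rotation ⟨c, mem_sphere_zero_iff_norm.2 hc⟩).measurePreserving
  exact volume_preserving_pi (fun _ : Fin m => h1)

theorem gaussDensity_smul {c : ℂ} (hc : ‖c‖ = 1) (w : Fin m → ℂ) :
    gaussDensity m ħ (c • w) = gaussDensity m ħ w := by
  simp [gaussDensity, hc]

theorem measurePreserving_smul_gaussMeasure {c : ℂ} (hc : ‖c‖ = 1) :
    MeasurePreserving (fun w : Fin m → ℂ => c • w) (gaussMeasure m ħ) (gaussMeasure m ħ) := by
  have hm : Measurable fun w : Fin m → ℂ => c • w := by fun_prop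
  have hd : Measurable fun z => ENNReal.ofReal (gaussDensity m ħ z) :=
    continuous_gaussDensity.measurable.ennreal_ofReal
  refine ⟨hm, Measure.ext fun s hs => ?_⟩
  rw [Measure.map_apply hm hs]
  rw [gaussMeasure_eq_withDensity, withDensity_apply _ (hm hs), withDensity_apply _ hs,
    ← (volume_preserving_smul_of_norm_eq_one (m := m) hc).setLIntegral_comp_preimage hs hd]
  simp only [gaussDensity_smul hc]

/-- The mean value property of entire functions for the Gaussian measure. -/
theorem integral_gaussMeasure_eq_apply_zero (hħ : 0 < ħ) {g : (Fin m → ℂ) → ℂ}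
    (hg : Differentiable ℂ g) (hi : Integrable g (gaussMeasure m ħ)) :
    ∫ w, g w ∂(gaussMeasure m ħ) = g 0 := by
  have := isProbabilityMeasure_gaussMeasure (m := m) hħ
  have hnorm : ∀ θ : ℝ, ‖circleMap 0 1 θ‖ = 1 := by simp
  -- On each complex line `t ↦ g (t • w)` is entire, so its circle average is its value at the
  -- centre. Averaging the rotation-invariant integral over the circle then leaves `g 0`.
  have hmean : ∀ w : Fin m → ℂ,
      (2 * Real.pi)⁻¹ • ∫ θ in Ioc 0 (2 * Real.pi), g (circleMap 0 1 θ • w) = g 0 := by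
    intro w
    have hd : Differentiable ℂ fun t : ℂ => g (t • w) :=
      hg.comp (differentiable_id.smul_const w)
    have h := hd.diffContOnCl (s := Metric.ball 0 |1|) |>.circleAverage
    rw [Real.circleAverage_def, intervalIntegral.integral_of_le Real.two_pi_pos.le] at h
    simpa using h
  have hmp : ∀ θ : ℝ, MeasurePreserving (fun w : Fin m → ℂ => circleMap 0 1 θ • w)
      (gaussMeasure m ħ) (gaussMeasure m ħ) := fun θ =>
    measurePreserving_smul_gaussMeasure (hnorm θ)
  have hemb : ∀ θ : ℝ, MeasurableEmbedding (fun w : Fin m → ℂ => circleMap 0 1 θ • w) := fun θ =>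
    measurableEmbedding_const_smul₀ (by rw [← norm_ne_zero_iff, hnorm]; exact one_ne_zero)
  have hint : Integrable (Function.uncurry fun (θ : ℝ) (w : Fin m → ℂ) => g (circleMap 0 1 θ • w))
      ((volume.restrict (Ioc 0 (2 * Real.pi))).prod (gaussMeasure m ħ)) := by
    rw [integrable_prod_iff]
    · refine ⟨Filter.Eventually.of_forall fun θ => ?_, ?_⟩
      · exact ((hmp θ).integrable_comp_emb (hemb θ)).2 hi
      · have : ∀ θ : ℝ, ∫ w, ‖g (circleMap 0 1 θ • w)‖ ∂(gaussMeasure m ħ) =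
            ∫ w, ‖g w‖ ∂(gaussMeasure m ħ) := fun θ =>
          (hmp θ).integral_comp (hemb θ) fun w => ‖g w‖
        simp only [Function.uncurry_apply_pair, this]
        exact integrable_const _
    · refine (hg.continuous.comp ?_).aestronglyMeasurable
      fun_prop
  have hswap := integral_integral_swap hint
  have h1 : ∀ θ : ℝ, ∫ w, g (circleMap 0 1 θ • w) ∂(gaussMeasure m ħ) =
      ∫ w, g w ∂(gaussMeasure m ħ) := fun θ => (hmp θ).integral_comp (hemb θ) g
  have h2 : ∀ w : Fin m → ℂ, ∫ θ in Ioc 0 (2 * Real.pi), g (circleMap 0 1 θ • w) =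
      (2 * Real.pi) • g 0 := by
    intro w
    rw [← hmean w, smul_inv_smul₀ Real.two_pi_pos.ne']
  simp only [h1, h2] at hswap
  rw [integral_const, integral_const] at hswap
  simpa [Real.pi_pos.le, Real.pi_pos.ne'] using hswap

/-- The exponential kernel `exp (z · w / ħ)`, with `z · w = ∑ⱼ zⱼ conj wⱼ`. -/
def expKernel (ħ : ℝ) (z w : Fin m → ℂ) : ℂ := Complex.exp ((∑ j, z j * conj (w j)) / ħ)

/-- The bound involves `z` only through `C`, which makes it uniform when `z` runs through an orbit
of `S^k`. -/
theorem norm_expKernel_le (hħ : 0 < ħ) (z w : Fin m → ℂ) {C : ℝ} (hC : ∀ j, ‖z j‖ ≤ C) :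
    ‖expKernel ħ z w‖ ≤ Real.exp (C / ħ * ∑ j, ‖w j‖) := by
  rw [expKernel, Complex.norm_exp]
  refine Real.exp_le_exp.2 ((Complex.re_le_norm _).trans ?_)
  rw [norm_div, Complex.norm_real, Real.norm_of_nonneg hħ.le, div_mul_eq_mul_div]
  refine div_le_div_of_nonneg_right ?_ hħ.le
  rw [Finset.mul_sum]
  refine norm_sum_le_of_le _ fun j _ => ?_
  rw [norm_mul, RCLike.norm_conj]
  exact mul_le_mul_of_nonneg_right (hC j) (norm_nonneg _)

@[fun_prop]
theorem continuous_expKernel (z : Fin m → ℂ) : Continuous (expKernel ħ z) := by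
  unfold expKernel; fun_prop

theorem memLp_of_norm_le_exp (hħ : 0 < ħ) {f : (Fin m → ℂ) → ℂ} (hf : Continuous f) (C : ℝ)
    (h : ∀ z, ‖f z‖ ≤ Real.exp (C * ∑ j, ‖z j‖)) : MemLp f 2 (gaussMeasure m ħ) :=
  (memLp_exp_gaussMeasure hħ C).mono hf.aestronglyMeasurable
    (Filter.Eventually.of_forall fun z => by simpa using h z)

theorem memLp_expKernel (hħ : 0 < ħ) (z : Fin m → ℂ) :
    MemLp (expKernel ħ z) 2 (gaussMeasure m ħ) :=
  memLp_of_norm_le_exp hħ (by fun_prop) ((∑ j, ‖z j‖) / ħ) fun w =>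
    norm_expKernel_le hħ z w fun j => Finset.single_le_sum (f := fun j => ‖z j‖)
      (fun _ _ => norm_nonneg _) (Finset.mem_univ j)

/-- Expanding `|w + z|²` produces the cross terms `w · z` and `z · w` and the term `|z|²`; the
kernel at `w + z` cancels all but the first of them. -/
theorem gaussDensity_mul_expKernel (z w : Fin m → ℂ) :
    (gaussDensity m ħ w : ℂ) * Complex.exp (-(∑ j, w j * conj (z j)) / ħ) =
      gaussDensity m ħ (w + z) * expKernel ħ z (w + z) := by
  simp only [gaussDensity, expKernel]
  push_cast
  rw [mul_assoc, mul_assoc, ← Complex.exp_add, ← Complex.exp_add, ← add_div, ← add_div]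
  congr 3
  have h : ∀ u : ℂ, ((‖u‖ : ℝ) : ℂ) ^ 2 = u * conj u := fun u => by
    rw [Complex.mul_conj, Complex.normSq_eq_norm_sq]; push_cast; rfl
  simp only [Pi.add_apply, h, map_add, ← Finset.sum_neg_distrib, ← Finset.sum_add_distrib]
  exact Finset.sum_congr rfl fun j _ => by ring

/-- The reproducing property of the exponential kernel. -/
theorem bargmann_reproducing (hħ : 0 < ħ) {f : (Fin m → ℂ) → ℂ} (hf : Differentiable ℂ f)
    (hL : MemLp f 2 (gaussMeasure m ħ)) (z : Fin m → ℂ) :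
    ∫ w, expKernel ħ z w * f w ∂(gaussMeasure m ħ) = f z := by
  set h : (Fin m → ℂ) → ℂ := fun u => (gaussDensity m ħ u : ℂ) * (expKernel ħ z u * f u) with hh
  -- Translation by `z` turns the integral against the kernel into the Gaussian mean of the entire
  -- function `g`, whose value at the origin is `f z`.
  set g : (Fin m → ℂ) → ℂ :=
    fun w => Complex.exp (-(∑ j, w j * conj (z j)) / ħ) * f (w + z) with hgdef
  have hgh : ∀ w, (gaussDensity m ħ w : ℂ) * g w = h (w + z) := by
    intro w
    simp only [hh, hgdef, ← mul_assoc, gaussDensity_mul_expKernel]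
  have hInt : Integrable h := by
    have := (integrable_gaussMeasure_iff hħ _).1 ((memLp_expKernel hħ z).integrable_mul hL)
    simpa only [Complex.real_smul, Pi.mul_apply] using this
  have hg : Differentiable ℂ g := by
    have h1 : Differentiable ℂ fun w : Fin m → ℂ => f (w + z) :=
      hf.comp (differentiable_id.add_const z)
    have h2 : Differentiable ℂ fun w : Fin m → ℂ =>
        Complex.exp (-(∑ j, w j * conj (z j)) / ħ) := by fun_prop
    exact h2.mul h1
  have hgi : Integrable g (gaussMeasure m ħ) := by
    rw [integrable_gaussMeasure_iff hħ]
    simp only [Complex.real_smul, hgh]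
    exact hInt.comp_add_right z
  have h0 := integral_gaussMeasure_eq_apply_zero hħ hg hgi
  rw [integral_gaussMeasure hħ] at h0 ⊢
  simp only [hgh] at h0
  rw [integral_add_right_eq_self h z] at h0
  rw [h0]
  simp [hgdef]

end Gauss

/-! ### Coherent states -/

theorem pairing_star {N : ℕ} (x : EuclideanSpace ℝ (Fin N)) (c : Fin N → ℂ) :
    pairing x (star c) = conj (pairing x c) := by
  simp [pairing]

theorem star_dotProduct_star_eq_zero {N : ℕ} {c : Fin N → ℂ} (hc : c ⬝ᵥ c = 0) :
    star c ⬝ᵥ star c = 0 := by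
  rw [Matrix.star_dotProduct_star, hc, star_zero]

theorem norm_coe_sphere {n : ℕ} (x : USphere n) : ‖(x : EuclideanSpace ℝ (Fin (n + 1)))‖ = 1 :=
  mem_sphere_zero_iff_norm.1 x.2

/-- The function `x ↦ (x · conj α)^l` on the sphere. -/
def powFun (n l : ℕ) (α : Fin (n + 1) → ℂ) : C(USphere n, ℂ) where
  toFun x := pairing x.1 (star α) ^ l
  continuous_toFun := by fun_prop

/-- The function `x ↦ (x · conj α)^l` as an element of `L²(S^n)`. -/
def powState (n l : ℕ) (α : Fin (n + 1) → ℂ) : L2Sphere n :=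
  ContinuousMap.toLp 2 (sphereMeasure n) ℂ (powFun n l α)

theorem norm_powFun_le (n l : ℕ) (α : Fin (n + 1) → ℂ) :
    ‖powFun n l α‖ ≤ (∑ i, ‖α i‖) ^ l := by
  rw [ContinuousMap.norm_le _ (by positivity)]
  intro x
  change ‖pairing x.1 (star α) ^ l‖ ≤ _
  rw [norm_pow]
  refine pow_le_pow_left₀ (norm_nonneg _) ?_ l
  simpa [norm_coe_sphere] using norm_pairing_le x.1 (star α)

theorem coherentFun_apply (n : ℕ) (ħ : ℝ) (α : Fin (n + 1) → ℂ) (x : USphere n) :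
    coherentFun n ħ α x = kernelSeries n (pairing x.1 (star α) / ħ) := rfl

theorem hasSum_coherentFun (n : ℕ) {ħ : ℝ} (hħ : 0 < ħ) (α : Fin (n + 1) → ℂ) :
    HasSum (fun l => ((kernelCoeff n l / ħ ^ l : ℝ) : ℂ) • powFun n l α) (coherentFun n ħ α) := by
  have hs : Summable fun l => ((kernelCoeff n l / ħ ^ l : ℝ) : ℂ) • powFun n l α := by
    refine Summable.of_norm_bounded
      (summable_kernelCoeff_mul_pow n ((∑ i, ‖α i‖) / ħ) (by positivity)) fun l => ?_
    rw [norm_smul, Complex.norm_real,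
      Real.norm_of_nonneg (div_nonneg (kernelCoeff_nonneg n l) (by positivity)), div_pow,
      div_mul_eq_mul_div, mul_div_assoc]
    have := kernelCoeff_nonneg n l
    have := norm_powFun_le n l α
    gcongr
  convert hs.hasSum using 1
  ext x
  rw [← (ContinuousMap.hasSum_apply hs.hasSum x).tsum_eq, coherentFun_apply, kernelSeries]
  refine tsum_congr fun l => ?_
  simp only [ContinuousMap.smul_apply, smul_eq_mul]
  change _ = _ * pairing x.1 (star α) ^ l
  push_cast
  rw [div_pow]
  ring

theorem hasSum_coherentState (n : ℕ) {ħ : ℝ} (hħ : 0 < ħ) (α : Fin (n + 1) → ℂ) :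
    HasSum (fun l => ((kernelCoeff n l / ħ ^ l : ℝ) : ℂ) • powState n l α)
      (coherentState n ħ α) := by
  have h := (hasSum_coherentFun n hħ α).mapL (ContinuousMap.toLp 2 (sphereMeasure n) ℂ)
  simp only [map_smul] at h
  exact h

theorem inner_powState_powState {n : ℕ} {α β : Fin (n + 1) → ℂ} (hα : α ⬝ᵥ α = 0)
    (hβ : β ⬝ᵥ β = 0) (k l : ℕ) :
    inner ℂ (powState n k α) (powState n l β) =
      if k = l then (l ! : ℂ) * (α ⬝ᵥ star β) ^ l / (stepTwoFactorial (n + 1) l : ℂ) else 0 := by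
  rw [powState, powState, ContinuousMap.inner_toLp]
  have h := integral_pairing_pow_mul_pairing_pow hα (star_dotProduct_star_eq_zero hβ) k l
  rw [show (∫ x : USphere n, powFun n l β x * conj (powFun n k α x) ∂(sphereMeasure n)) =
    ∫ x : USphere n, pairing x.1 α ^ k * pairing x.1 (star β) ^ l ∂(sphereMeasure n) from ?_, h]
  · split_ifs with hkl
    · rw [hkl]
    · rfl
  · refine integral_congr_ae (Filter.Eventually.of_forall fun x => ?_)
    change pairing x.1 (star β) ^ l * conj (pairing x.1 (star α) ^ k) = _
    rw [map_pow, ← pairing_star, star_star, mul_comm]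

theorem inner_coherentState_powState {n : ℕ} {ħ : ℝ} (hħ : 0 < ħ) {α β : Fin (n + 1) → ℂ}
    (hα : α ⬝ᵥ α = 0) (hβ : β ⬝ᵥ β = 0) (l : ℕ) :
    inner ℂ (coherentState n ħ α) (powState n l β) =
      ((kernelCoeff n l / ħ ^ l : ℝ) : ℂ) *
        ((l ! : ℂ) * (α ⬝ᵥ star β) ^ l / (stepTwoFactorial (n + 1) l : ℂ)) := by
  have h1 := ((hasSum_coherentState n hħ α).mapL
    (innerSL ℂ (powState n l β))).star
  simp only [innerSL_apply_apply, inner_smul_right, star_mul', RCLike.star_def,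
    Complex.conj_ofReal, inner_conj_symm] at h1
  rw [← h1.tsum_eq, tsum_eq_single l fun k hk => by
    rw [inner_powState_powState hα hβ, if_neg hk, mul_zero], inner_powState_powState hα hβ,
    if_pos rfl]

/-- Both sides are the product `(k + 1)(k + 3) ⋯ (k + 2l + 1)`. -/
theorem stepTwoFactorial_add_two (k l : ℕ) :
    stepTwoFactorial (k + 3) l * (k + 1) = stepTwoFactorial (k + 1) l * (k + 1 + 2 * l) := by
  induction l with
  | zero => simp [stepTwoFactorial_zero]
  | succ l ih =>
    rw [stepTwoFactorial_succ, stepTwoFactorial_succ]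
    push_cast
    linear_combination ((k : ℝ) + 3 + 2 * l) * ih

/-- This is why the coherent states carry the coefficient `√(2l + n - 1) / (l! √(n - 1))`: with `n =
k + 2`, its square converts the moment denominators of `S^(k+2)` into those of `S^k`. -/
theorem kernelCoeff_sq (k l : ℕ) :
    kernelCoeff (k + 2) l ^ 2 * ((l ! : ℝ) / stepTwoFactorial (k + 3) l) =
      1 / ((l ! : ℝ) * stepTwoFactorial (k + 1) l) := by
  have h1 := stepTwoFactorial_pos (Nat.succ_pos k) l
  have h3 := stepTwoFactorial_pos (Nat.succ_pos (k + 2)) l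
  have h := stepTwoFactorial_add_two k l
  have hl : (0 : ℝ) < (l ! : ℝ) := by exact_mod_cast Nat.factorial_pos l
  have hk : (0 : ℝ) < (k : ℝ) + 1 := by positivity
  unfold kernelCoeff
  rw [div_pow, mul_pow, Real.sq_sqrt (by push_cast; linarith [Nat.cast_nonneg (α := ℝ) l]),
    Real.sq_sqrt (by push_cast; linarith)]
  have e : ((k + 2 : ℕ) : ℝ) - 1 = k + 1 := by push_cast; ring
  rw [add_sub_assoc, e, div_mul_div_comm, div_eq_div_iff (by positivity) (by positivity)]
  linear_combination (-(l ! : ℝ) ^ 2) * h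

/-- Isotropy makes the homogeneous components of different degrees orthogonal, so only the diagonal
terms remain. The result is to be compared with `hasSum_integral_exp_pairing` on `S^k`. -/
theorem hasSum_inner_coherentState (k : ℕ) {ħ : ℝ} (hħ : 0 < ħ) {α β : Fin (k + 2 + 1) → ℂ}
    (hα : α ⬝ᵥ α = 0) (hβ : β ⬝ᵥ β = 0) :
    HasSum (fun l : ℕ => (α ⬝ᵥ star β) ^ l /
        ((ħ : ℂ) ^ (2 * l) * ((l ! : ℂ) * (stepTwoFactorial (k + 1) l : ℂ))))
      (inner ℂ (coherentState (k + 2) ħ α) (coherentState (k + 2) ħ β)) := by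
  have h1 := (hasSum_coherentState (k + 2) hħ β).mapL
    (innerSL ℂ (coherentState (k + 2) ħ α))
  simp only [innerSL_apply_apply, inner_smul_right, inner_coherentState_powState hħ hα hβ] at h1
  refine h1.congr_fun fun l => ?_
  have h2 : ((kernelCoeff (k + 2) l ^ 2 * ((l ! : ℝ) / stepTwoFactorial (k + 3) l) : ℝ) : ℂ) =
      _ := congrArg _ (kernelCoeff_sq k l)
  push_cast at h2
  have hħ' : (ħ : ℂ) ≠ 0 := by exact_mod_cast hħ.ne'
  push_cast
  calc _ = ((α ⬝ᵥ star β) ^ l / (ħ : ℂ) ^ (2 * l)) *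
        (1 / ((l ! : ℂ) * (stepTwoFactorial (k + 1) l : ℂ))) := by
        rw [div_mul_div_comm, mul_one]
    _ = _ := by
        rw [← h2, mul_comm 2 l, pow_mul]
        field_simp

/-- The spherical average of an exponential. -/
theorem hasSum_integral_exp_pairing (k : ℕ) (c : Fin (k + 1) → ℂ) (ħ : ℝ) :
    HasSum (fun l : ℕ => (c ⬝ᵥ c) ^ l /
        ((ħ : ℂ) ^ (2 * l) * (2 ^ l * (l ! : ℂ) * (stepTwoFactorial (k + 1) l : ℂ))))
      (∫ x : USphere k, Complex.exp (pairing x.1 c / ħ) ∂(sphereMeasure k)) := by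
  set F : ℕ → USphere k → ℂ := fun N x => (pairing x.1 c / ħ) ^ N / (N ! : ℂ) with hF
  have hFi : ∀ N, Integrable (F N) (sphereMeasure k) := fun N =>
    Continuous.integrable_of_hasCompactSupport (by simp only [hF]; fun_prop)
      (HasCompactSupport.of_compactSpace _)
  have hb : ∀ N x, ‖F N x‖ ≤ ((∑ i, ‖c i‖) / |ħ|) ^ N / (N ! : ℝ) := by
    intro N x
    simp only [hF, norm_div, norm_pow, Complex.norm_real, Complex.norm_natCast, Real.norm_eq_abs]
    gcongr
    simpa [norm_coe_sphere] using norm_pairing_le x.1 c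
  have hS : Summable fun N => ∫ x, ‖F N x‖ ∂(sphereMeasure k) := by
    refine Summable.of_nonneg_of_le (fun N => integral_nonneg fun x => norm_nonneg _) (fun N => ?_)
      (Real.summable_pow_div_factorial ((∑ i, ‖c i‖) / |ħ|))
    have := integral_mono (hFi N).norm (integrable_const _) (hb N)
    simpa using this
  have h := hasSum_integral_of_summable_integral_norm hFi hS
  have he : ∀ x : USphere k, ∑' N, F N x = Complex.exp (pairing x.1 c / ħ) := fun x => by
    rw [Complex.exp_eq_exp_ℂ, NormedSpace.exp_eq_tsum_div]
  simp only [he] at h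
  -- Odd moments vanish, so the exponential series may be summed over even degrees only.
  have hinj : Function.Injective fun l : ℕ => 2 * l := mul_right_injective₀ two_ne_zero
  rw [← hinj.hasSum_iff] at h
  · refine h.congr_fun fun l => ?_
    simp only [Function.comp_apply, hF, div_pow]
    rw [integral_div, integral_div, integral_pairing_pow_even]
    have : (((2 * l)! : ℕ) : ℂ) ≠ 0 := by exact_mod_cast Nat.factorial_ne_zero _
    field_simp
  · intro N hN
    have hodd : Odd N := by
      rw [← Nat.not_even_iff_odd]
      rintro ⟨l, hl⟩
      exact hN ⟨l, by simp only; omega⟩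
    obtain ⟨l, rfl⟩ := hodd
    simp only [hF, div_pow]
    rw [integral_div, integral_div, integral_pairing_pow_odd, zero_div, zero_div]

/-! ### The transform as a function on `ℂ^(n+1)` -/

/-- The function `α ↦ ∫ K(x · α / ħ) ψ(x) dΩ(x)`. -/
def coneTransform (n : ℕ) (ħ : ℝ) (ψ : L2Sphere n) (α : Fin (n + 1) → ℂ) : ℂ :=
  ∫ x : USphere n, kernelSeries n (pairing x.1 α / ħ) * ψ x ∂(sphereMeasure n)

theorem conj_kernelSeries (n : ℕ) (t : ℂ) : conj (kernelSeries n t) = kernelSeries n (conj t) := by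
  rw [kernelSeries, kernelSeries, Complex.conj_tsum]
  simp

theorem coneTransform_eq_inner (n : ℕ) (ħ : ℝ) (ψ : L2Sphere n) (α : Fin (n + 1) → ℂ) :
    coneTransform n ħ ψ α = inner ℂ (coherentState n ħ α) ψ := by
  rw [L2.inner_def, coneTransform]
  refine integral_congr_ae ?_
  filter_upwards [ContinuousMap.coeFn_toLp (p := 2) (𝕜 := ℂ) (sphereMeasure n)
    (coherentFun n ħ α)] with x hx
  rw [coherentState, hx, RCLike.inner_apply, mul_comm, coherentFun_apply, conj_kernelSeries,
    map_div₀, Complex.conj_ofReal, ← pairing_star, star_star]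

theorem differentiable_kernelSeries (n : ℕ) : Differentiable ℂ (kernelSeries n) := by
  intro t
  have hd : DifferentiableOn ℂ (kernelSeries n) (Metric.ball 0 (‖t‖ + 1)) := by
    refine Complex.differentiableOn_tsum_of_summable_norm
      (summable_kernelCoeff_mul_pow n (‖t‖ + 1) (by positivity))
      (fun l => Differentiable.differentiableOn (by fun_prop)) Metric.isOpen_ball (fun l s hs => ?_)
    rw [norm_mul, norm_pow, Complex.norm_real, Real.norm_of_nonneg (kernelCoeff_nonneg n l)]
    refine mul_le_mul_of_nonneg_left (pow_le_pow_left₀ (norm_nonneg _) ?_ l)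
      (kernelCoeff_nonneg n l)
    exact (mem_ball_zero_iff.1 hs).le
  exact hd.differentiableAt (Metric.isOpen_ball.mem_nhds (by simp))

/-- The pairing with a fixed real vector, as a continuous linear functional. -/
def pairingCLM {N : ℕ} (x : EuclideanSpace ℝ (Fin N)) : (Fin N → ℂ) →L[ℂ] ℂ :=
  ∑ i, ((x i : ℝ) : ℂ) • ContinuousLinearMap.proj i

theorem pairingCLM_apply {N : ℕ} (x : EuclideanSpace ℝ (Fin N)) (c : Fin N → ℂ) :
    pairingCLM x c = pairing x c := by
  simp [pairingCLM, pairing]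

@[fun_prop]
theorem continuous_pairingCLM {N : ℕ} : Continuous (pairingCLM (N := N)) := by
  unfold pairingCLM; fun_prop

theorem differentiable_coneTransform (n : ℕ) (ħ : ℝ) (ψ : L2Sphere n) :
    Differentiable ℂ (coneTransform n ħ ψ) := by
  intro α₀
  have hψ : Integrable ψ (sphereMeasure n) := (Lp.memLp ψ).integrable one_le_two
  have hK := differentiable_kernelSeries n
  have hK' : Continuous (deriv (kernelSeries n)) := hK.contDiff.continuous_deriv (n := 1) le_rfl
  set G : (Fin (n + 1) → ℂ) → USphere n → ((Fin (n + 1) → ℂ) →L[ℂ] ℂ) := fun α x =>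
    deriv (kernelSeries n) (pairing x.1 α / ħ) • ((ħ : ℂ)⁻¹ • pairingCLM x.1) with hG
  have hpc : Continuous fun p : (Fin (n + 1) → ℂ) × USphere n => pairing p.2.1 p.1 := by
    unfold pairing; fun_prop
  have hGc : Continuous fun p : (Fin (n + 1) → ℂ) × USphere n => G p.1 p.2 := by
    have h1 := hK'.comp (hpc.div_const (ħ : ℂ))
    simp only [Function.comp_def] at h1
    simp only [hG]
    fun_prop
  -- Compactness of the ball times the sphere bounds the derivative of the kernel uniformly, as
  -- required for differentiating under the integral.
  obtain ⟨M, hM⟩ := ((isCompact_closedBall α₀ 1).prod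
    (isCompact_univ (X := USphere n))).exists_bound_of_continuousOn hGc.continuousOn
  have key := hasFDerivAt_integral_of_dominated_of_fderiv_le (μ := sphereMeasure n) (𝕜 := ℂ)
    (F := fun α x => kernelSeries n (pairing x.1 α / ħ) * ψ x) (F' := fun α x => ψ x • G α x)
    (x₀ := α₀) (bound := fun x => M * ‖ψ x‖) (Metric.closedBall_mem_nhds α₀ one_pos)
    (Filter.Eventually.of_forall fun α => ?_) ?_ ?_ ?_ ?_ ?_
  · exact key.differentiableAt
  · refine (Continuous.aestronglyMeasurable ?_).mul hψ.aestronglyMeasurable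
    exact hK.continuous.comp (by fun_prop)
  · let f : C(USphere n, ℂ) :=
      ⟨fun x => kernelSeries n (pairing x.1 α₀ / ħ), hK.continuous.comp (by fun_prop)⟩
    exact hψ.bdd_mul (c := ‖f‖) f.continuous.aestronglyMeasurable
      (Filter.Eventually.of_forall fun x => f.norm_coe_le_norm x)
  · exact hψ.aestronglyMeasurable.smul
      (hGc.comp (Continuous.prodMk_right α₀)).aestronglyMeasurable
  · refine Filter.Eventually.of_forall fun x α hα => ?_
    rw [norm_smul, mul_comm]
    exact mul_le_mul_of_nonneg_right (hM (α, x) ⟨hα, mem_univ _⟩) (norm_nonneg _)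
  · exact hψ.norm.const_mul M
  · refine Filter.Eventually.of_forall fun x α _ => ?_
    have h1 : HasFDerivAt (fun α => pairing x.1 α / (ħ : ℂ)) ((ħ : ℂ)⁻¹ • pairingCLM x.1) α := by
      have := ((ħ : ℂ)⁻¹ • pairingCLM x.1).hasFDerivAt (x := α)
      refine this.congr_of_eventuallyEq (Filter.Eventually.of_forall fun β => ?_)
      simp [pairingCLM_apply, div_eq_inv_mul]
    exact ((hK _).hasDerivAt.comp_hasFDerivAt α h1).mul_const (ψ x)

/-! ### Completeness of the coherent states -/

theorem kernelCoeff_pos (k l : ℕ) : 0 < kernelCoeff (k + 2) l := by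
  have hl : (0 : ℝ) < (l ! : ℝ) := by exact_mod_cast Nat.factorial_pos l
  have h1 : (0 : ℝ) < 2 * (l : ℝ) + ((k + 2 : ℕ) : ℝ) - 1 := by
    push_cast
    linarith [Nat.cast_nonneg (α := ℝ) l, Nat.cast_nonneg (α := ℝ) k]
  have h2 : (0 : ℝ) < ((k + 2 : ℕ) : ℝ) - 1 := by
    push_cast
    linarith [Nat.cast_nonneg (α := ℝ) k]
  exact div_pos (Real.sqrt_pos.2 h1) (mul_pos hl (Real.sqrt_pos.2 h2))

theorem inner_powState (n l : ℕ) (α : Fin (n + 1) → ℂ) (ψ : L2Sphere n) :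
    inner ℂ (powState n l α) ψ = ∫ x : USphere n, pairing x.1 α ^ l * ψ x ∂(sphereMeasure n) := by
  rw [L2.inner_def]
  refine integral_congr_ae ?_
  filter_upwards [ContinuousMap.coeFn_toLp (p := 2) (𝕜 := ℂ) (sphereMeasure n)
    (powFun n l α)] with x hx
  rw [powState, hx, RCLike.inner_apply, mul_comm]
  change conj (pairing x.1 (star α) ^ l) * _ = _
  rw [map_pow, ← pairing_star, star_star]

theorem powState_smul (n l : ℕ) (a : ℂ) (α : Fin (n + 1) → ℂ) :
    powState n l (a • α) = conj a ^ l • powState n l α := by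
  rw [powState, powState, ← map_smul]
  congr 1
  ext x
  change pairing x.1 (star (a • α)) ^ l = conj a ^ l • pairing x.1 (star α) ^ l
  rw [star_smul, pairing_smul_right, mul_pow, smul_eq_mul, RCLike.star_def]

theorem hasSum_inner_coherentState_left (n : ℕ) {ħ : ℝ} (hħ : 0 < ħ) (α : Fin (n + 1) → ℂ)
    (ψ : L2Sphere n) :
    HasSum (fun l => ((kernelCoeff n l / ħ ^ l : ℝ) : ℂ) * inner ℂ (powState n l α) ψ)
      (inner ℂ (coherentState n ħ α) ψ) := by
  have h := ((hasSum_coherentState n hħ α).mapL (innerSL ℂ ψ)).star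
  simpa only [innerSL_apply_apply, inner_smul_right, star_mul', RCLike.star_def,
    Complex.conj_ofReal, inner_conj_symm] using h

/-- Along the line `t • α` the inner product is a power series in `t` whose coefficients are nonzero
multiples of those with the powers; if it vanishes identically, so does every coefficient. -/
theorem inner_powState_eq_zero {k : ℕ} {ħ : ℝ} (hħ : 0 < ħ) {ψ : L2Sphere (k + 2)}
    {α : Fin (k + 2 + 1) → ℂ}
    (h : ∀ t : ℂ, inner ℂ (coherentState (k + 2) ħ (t • α)) ψ = 0) (l : ℕ) :
    inner ℂ (powState (k + 2) l α) ψ = 0 := by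
  set a : ℕ → ℂ := fun l => ((kernelCoeff (k + 2) l / ħ ^ l : ℝ) : ℂ) *
    inner ℂ (powState (k + 2) l α) ψ with ha
  have hp : HasFPowerSeriesAt (0 : ℂ → ℂ) (FormalMultilinearSeries.ofScalars ℂ a) 0 := by
    rw [hasFPowerSeriesAt_iff]
    refine Filter.Eventually.of_forall fun t => ?_
    have h1 := hasSum_inner_coherentState_left (k + 2) hħ (t • α) ψ
    rw [h t] at h1
    simp only [Pi.zero_apply]
    refine h1.congr_fun fun l => ?_
    rw [FormalMultilinearSeries.coeff_ofScalars, powState_smul, inner_smul_left, map_pow,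
      Complex.conj_conj, smul_eq_mul, ha]
    ring
  have h0 := hp.eq_zero
  have hl : a l = 0 := by
    rw [← FormalMultilinearSeries.coeff_ofScalars (𝕜 := ℂ) (p := a) (n := l), h0]
    rfl
  refine (mul_eq_zero.1 hl).resolve_left ?_
  have := kernelCoeff_pos k l
  exact_mod_cast (by positivity : kernelCoeff (k + 2) l / ħ ^ l ≠ 0)

/-! ### Laplace's integral and zonal polynomials. -/

/-- The complexification of a real vector. -/
def toComplexVec {N : ℕ} (y : EuclideanSpace ℝ (Fin N)) : Fin N → ℂ := fun i => (y i : ℂ)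

theorem pairing_toComplexVec {N : ℕ} (x y : EuclideanSpace ℝ (Fin N)) :
    pairing x (toComplexVec y) = ((inner ℝ x y : ℝ) : ℂ) := by
  simp [pairing, toComplexVec, PiLp.inner_apply, mul_comm]

theorem toComplexVec_dotProduct {N : ℕ} (x y : EuclideanSpace ℝ (Fin N)) :
    toComplexVec x ⬝ᵥ toComplexVec y = ((inner ℝ x y : ℝ) : ℂ) :=
  pairing_toComplexVec x y

theorem isotropic_of_orthogonal {N : ℕ} {y u : EuclideanSpace ℝ (Fin N)} (h : ‖y‖ = ‖u‖)
    (ho : inner ℝ y u = 0) :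
    (toComplexVec y + Complex.I • toComplexVec u) ⬝ᵥ
      (toComplexVec y + Complex.I • toComplexVec u) = 0 := by
  simp only [add_dotProduct, dotProduct_add, smul_dotProduct, dotProduct_smul,
    toComplexVec_dotProduct, real_inner_self_eq_norm_sq, real_inner_comm y u, ho, h, smul_eq_mul]
  push_cast
  linear_combination (‖u‖ : ℂ) ^ 2 * Complex.I_mul_I

/-- The moments of a coordinate on `S^n`. -/
def coordMoment (n j : ℕ) : ℝ :=
  if Even j then (j ! : ℝ) / (2 ^ (j / 2) * ((j / 2)! : ℝ) * stepTwoFactorial (n + 1) (j / 2))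
  else 0

theorem coordMoment_nonneg (n j : ℕ) : 0 ≤ coordMoment n j := by
  unfold coordMoment
  have := stepTwoFactorial_pos (Nat.succ_pos n) (j / 2)
  split_ifs <;> positivity

theorem coordMoment_zero (n : ℕ) : coordMoment n 0 = 1 := by
  simp [coordMoment, stepTwoFactorial_zero]

theorem integral_pairing_pow (n : ℕ) (c : Fin (n + 1) → ℂ) (j : ℕ) :
    ∫ x : USphere n, pairing x.1 c ^ j ∂(sphereMeasure n) =
      coordMoment n j * (c ⬝ᵥ c) ^ (j / 2) := by
  unfold coordMoment
  rcases Nat.even_or_odd' j with ⟨l, rfl | rfl⟩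
  · rw [integral_pairing_pow_even, if_pos (even_two_mul l), Nat.mul_div_cancel_left l two_pos]
    push_cast
    ring
  · rw [integral_pairing_pow_odd, if_neg (Nat.not_even_two_mul_add_one l)]
    simp

open Polynomial in
/-- The zonal polynomial obtained from Laplace's integral: the average of
`(t + i √(1 - t²) v₀)^l` over `v ∈ S^n`. -/
def laplacePoly (n l : ℕ) : ℝ[X] :=
  ∑ j ∈ Finset.range (l + 1), C ((l.choose j : ℝ) * coordMoment n j) *
    (X ^ (l - j) * (X ^ 2 - 1) ^ (j / 2))

-- No cancellation occurs in degree `l`: the terms with `j` odd vanish, those with `j` even have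
-- nonnegative coefficient there, and `j = 0` contributes `1`.
open Polynomial in
theorem degree_laplacePoly (n l : ℕ) : (laplacePoly n l).degree = l := by
  have hmonic : ∀ j, (X ^ (l - j) * (X ^ 2 - 1 : ℝ[X]) ^ (j / 2)).Monic := fun j =>
    (monic_X_pow _).mul ((monic_X_pow_sub_C (1 : ℝ) two_ne_zero).pow _)
  have hdeg : ∀ j, (X ^ (l - j) * (X ^ 2 - 1 : ℝ[X]) ^ (j / 2)).natDegree
      = (l - j) + 2 * (j / 2) := fun j => by
    have h1 : (X ^ 2 - 1 : ℝ[X]).Monic := monic_X_pow_sub_C (1 : ℝ) two_ne_zero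
    have h2 : (X ^ 2 - 1 : ℝ[X]).natDegree = 2 := natDegree_X_pow_sub_C (r := (1 : ℝ))
    rw [(monic_X_pow _).natDegree_mul (h1.pow _), natDegree_X_pow, h1.natDegree_pow, h2, mul_comm]
  refine degree_eq_of_le_of_coeff_ne_zero ?_ ?_
  · refine (degree_sum_le _ _).trans (Finset.sup_le fun j hj => ?_)
    refine degree_le_of_natDegree_le ((natDegree_C_mul_le _ _).trans ?_)
    rw [hdeg]
    have := Finset.mem_range.1 hj
    exact_mod_cast (by omega : (l - j) + 2 * (j / 2) ≤ l)
  · rw [laplacePoly, finsetSum_coeff]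
    have hterm : ∀ j ∈ Finset.range (l + 1), (C ((l.choose j : ℝ) * coordMoment n j) *
        (X ^ (l - j) * (X ^ 2 - 1) ^ (j / 2))).coeff l = (l.choose j : ℝ) * coordMoment n j := by
      intro j hj
      have := Finset.mem_range.1 hj
      rw [coeff_C_mul]
      by_cases he : Even j
      · have hl : (X ^ (l - j) * (X ^ 2 - 1 : ℝ[X]) ^ (j / 2)).natDegree = l := by
          rw [hdeg, Nat.two_mul_div_two_of_even he]; omega
        have := (hmonic j).coeff_natDegree
        rw [hl] at this
        rw [this, mul_one]
      · simp [coordMoment, he]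
    rw [Finset.sum_congr rfl hterm]
    refine ne_of_gt ?_
    refine Finset.sum_pos' (fun j _ => mul_nonneg (Nat.cast_nonneg _) (coordMoment_nonneg n j))
      ⟨0, by simp, by simp [coordMoment_zero]⟩

theorem integral_add_pairing_pow {n : ℕ} (t : ℝ) (c : Fin (n + 1) → ℂ)
    (hc : c ⬝ᵥ c = 1 - (t : ℂ) ^ 2) (l : ℕ) :
    ∫ v : USphere n, ((t : ℂ) + Complex.I * pairing v.1 c) ^ l ∂(sphereMeasure n) =
      (((laplacePoly n l).eval t : ℝ) : ℂ) := by
  have h1 : ∀ v : USphere n, ((t : ℂ) + Complex.I * pairing v.1 c) ^ l =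
      ∑ j ∈ Finset.range (l + 1), ((t : ℂ) ^ (l - j) * Complex.I ^ j * (l.choose j : ℂ)) *
        pairing v.1 c ^ j := by
    intro v
    rw [add_comm, add_pow]
    exact Finset.sum_congr rfl fun j _ => by rw [mul_pow]; ring
  simp only [h1]
  rw [integral_finsetSum _ fun j _ => Continuous.integrable_of_hasCompactSupport (by fun_prop)
      (HasCompactSupport.of_compactSpace _)]
  simp only [integral_const_mul, integral_pairing_pow, hc, laplacePoly, Polynomial.eval_finsetSum,
    Polynomial.eval_mul, Polynomial.eval_C, Polynomial.eval_pow, Polynomial.eval_X,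
    Polynomial.eval_sub, Polynomial.eval_one]
  push_cast
  refine Finset.sum_congr rfl fun j _ => ?_
  by_cases he : Even j
  · obtain ⟨i, rfl⟩ := he
    rw [← two_mul, Nat.mul_div_cancel_left i two_pos, pow_mul Complex.I, Complex.I_sq,
      show ((t : ℂ) ^ 2 - 1) = (-1) * (1 - (t : ℂ) ^ 2) by ring, mul_pow]
    ring
  · simp [coordMoment, he]

theorem integrable_mul_of_continuous {n : ℕ} {f : USphere n → ℂ} (hf : Continuous f)
    (ψ : L2Sphere n) : Integrable (fun x => f x * ψ x) (sphereMeasure n) := by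
  have hψ : Integrable ψ (sphereMeasure n) := (Lp.memLp ψ).integrable one_le_two
  exact hψ.bdd_mul (c := ‖(⟨f, hf⟩ : C(USphere n, ℂ))‖) hf.aestronglyMeasurable
    (Filter.Eventually.of_forall fun x => ContinuousMap.norm_coe_le_norm ⟨f, hf⟩ x)

/-- A function orthogonal to the powers of all isotropic linear forms is orthogonal to the powers
of all real linear forms. -/
theorem integral_laplacePoly_eq_zero {k : ℕ} {ψ : L2Sphere (k + 2)}
    (h : ∀ α : Fin (k + 2 + 1) → ℂ, α ⬝ᵥ α = 0 → ∀ l, inner ℂ (powState (k + 2) l α) ψ = 0)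
    {y : EuclideanSpace ℝ (Fin (k + 2 + 1))} (hy : ‖y‖ = 1) (l : ℕ) :
    ∫ x : USphere (k + 2), (((laplacePoly (k + 1) l).eval (inner ℝ x.1 y) : ℝ) : ℂ) * ψ x
      ∂(sphereMeasure (k + 2)) = 0 := by
  -- Complete `y` to an orthonormal basis. The remaining vectors identify `S^(k+1)` with the unit
  -- sphere of `y^⊥` through `u`, and each `y + i u(v)` is isotropic.
  obtain ⟨e, he⟩ := Orthonormal.exists_orthonormalBasis_extension_of_card_eq (𝕜 := ℝ)
    (E := EuclideanSpace ℝ (Fin (k + 2 + 1))) (ι := Fin (k + 2 + 1)) (by simp)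
    (v := fun _ => y) (s := {0}) (by
      rw [orthonormal_iff_ite]
      intro i j
      rw [if_pos (Subsingleton.elim i j)]
      simp [hy])
  have he0 : e 0 = y := he 0 rfl
  set b : Fin (k + 1 + 1) → EuclideanSpace ℝ (Fin (k + 2 + 1)) := fun j => e j.succ with hb
  set u : EuclideanSpace ℝ (Fin (k + 1 + 1)) → EuclideanSpace ℝ (Fin (k + 2 + 1)) :=
    fun v => ∑ j, v j • b j with hu
  set c : EuclideanSpace ℝ (Fin (k + 2 + 1)) → Fin (k + 1 + 1) → ℂ :=
    fun x j => ((inner ℝ x (b j) : ℝ) : ℂ) with hcdef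
  set α : EuclideanSpace ℝ (Fin (k + 1 + 1)) → Fin (k + 2 + 1) → ℂ :=
    fun v => toComplexVec y + Complex.I • toComplexVec (u v) with hα
  have hb_on : Orthonormal ℝ b := e.orthonormal.comp _ (Fin.succ_injective _)
  have hyu : ∀ v, inner ℝ y (u v) = 0 := by
    intro v
    rw [hu, inner_sum]
    refine Finset.sum_eq_zero fun j _ => ?_
    rw [real_inner_smul_right, ← he0, hb, e.orthonormal.2 (Fin.succ_ne_zero j).symm, mul_zero]
  have hun : ∀ v : USphere (k + 1), ‖u v.1‖ = 1 := by
    intro v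
    have h1 : ‖u v.1‖ ^ 2 = ‖v.1‖ ^ 2 := by
      rw [← real_inner_self_eq_norm_sq, hu, hb_on.inner_sum, EuclideanSpace.norm_sq_eq]
      simp [sq]
    rw [norm_coe_sphere, one_pow] at h1
    nlinarith [norm_nonneg (u v.1)]
  have hnull : ∀ v : USphere (k + 1), α v.1 ⬝ᵥ α v.1 = 0 := fun v =>
    isotropic_of_orthogonal (by rw [hy, hun]) (hyu v.1)
  have hpair : ∀ x v, pairing x (α v) = ((inner ℝ x y : ℝ) : ℂ) + Complex.I * pairing v (c x) := by
    intro x v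
    rw [hα, pairing_add_right, pairing_smul_right, pairing_toComplexVec, pairing_toComplexVec, hu,
      inner_sum, pairing]
    congr 2
    push_cast
    exact Finset.sum_congr rfl fun j _ => by rw [real_inner_smul_right]; push_cast; rfl
  have hc : ∀ x : USphere (k + 2), c x.1 ⬝ᵥ c x.1 = 1 - ((inner ℝ x.1 y : ℝ) : ℂ) ^ 2 := by
    intro x
    have h1 := e.sum_sq_norm_inner_left x.1
    rw [Fin.sum_univ_succ, he0, norm_coe_sphere, one_pow] at h1
    simp only [Real.norm_eq_abs, sq_abs] at h1
    rw [eq_sub_iff_add_eq, add_comm, dotProduct]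
    simp only [hcdef, hb, ← sq]
    exact_mod_cast h1
  have hcont : Continuous fun p : USphere (k + 2) × USphere (k + 1) => pairing p.1.1 (α p.2.1) := by
    simp_rw [hpair]
    simp only [pairing, hcdef]
    fun_prop
  have hint : Integrable (Function.uncurry fun (x : USphere (k + 2)) (v : USphere (k + 1)) =>
      pairing x.1 (α v.1) ^ l * ψ x) ((sphereMeasure (k + 2)).prod (sphereMeasure (k + 1))) := by
    have hψ : Integrable ψ (sphereMeasure (k + 2)) := (Lp.memLp ψ).integrable one_le_two
    let f : C(USphere (k + 2) × USphere (k + 1), ℂ) := ⟨_, hcont.pow l⟩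
    exact (hψ.comp_fst (sphereMeasure (k + 1))).bdd_mul (c := ‖f‖) f.continuous.aestronglyMeasurable
      (Filter.Eventually.of_forall fun p => f.norm_coe_le_norm p)
  -- Integrating over `x` first gives zero by hypothesis; integrating over `v` first gives the zonal
  -- polynomial in `x · y`.
  have hswap := integral_integral_swap hint
  have h1 : ∀ x : USphere (k + 2), ∫ v : USphere (k + 1), pairing x.1 (α v.1) ^ l * ψ x
      ∂(sphereMeasure (k + 1)) =
      (((laplacePoly (k + 1) l).eval (inner ℝ x.1 y) : ℝ) : ℂ) * ψ x := by
    intro x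
    rw [integral_mul_const]
    simp only [hpair]
    rw [integral_add_pairing_pow _ _ (hc x)]
  have h2 : ∀ v : USphere (k + 1), ∫ x : USphere (k + 2), pairing x.1 (α v.1) ^ l * ψ x
      ∂(sphereMeasure (k + 2)) = 0 := fun v => by
    rw [← inner_powState, h _ (hnull v)]
  simp only [h1, h2, integral_zero] at hswap
  exact hswap

-- The Laplace polynomials have one member of each degree, so they span all real polynomials, in
-- particular the monomials.
open Polynomial in
theorem integral_inner_pow_eq_zero {k : ℕ} {ψ : L2Sphere (k + 2)}
    (h : ∀ α : Fin (k + 2 + 1) → ℂ, α ⬝ᵥ α = 0 → ∀ l, inner ℂ (powState (k + 2) l α) ψ = 0)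
    {y : EuclideanSpace ℝ (Fin (k + 2 + 1))} (hy : ‖y‖ = 1) (l : ℕ) :
    ∫ x : USphere (k + 2), ((inner ℝ x.1 y : ℝ) : ℂ) ^ l * ψ x ∂(sphereMeasure (k + 2)) = 0 := by
  have hi : ∀ p : ℝ[X], Integrable (fun x : USphere (k + 2) =>
      ((p.eval (inner ℝ x.1 y) : ℝ) : ℂ) * ψ x) (sphereMeasure (k + 2)) := fun p =>
    integrable_mul_of_continuous (by fun_prop) ψ
  let Λ : ℝ[X] →ₗ[ℝ] ℂ :=
    { toFun := fun p => ∫ x : USphere (k + 2), ((p.eval (inner ℝ x.1 y) : ℝ) : ℂ) * ψ x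
        ∂(sphereMeasure (k + 2))
      map_add' := fun p q => by
        rw [← integral_add (hi p) (hi q)]
        simp [add_mul]
      map_smul' := fun a p => by
        rw [RingHom.id_apply, Complex.real_smul, ← integral_const_mul]
        simp [mul_assoc] }
  let S : Polynomial.Sequence ℝ := ⟨laplacePoly (k + 1), degree_laplacePoly (k + 1)⟩
  have hS := S.span fun i => isUnit_iff_ne_zero.2 (leadingCoeff_ne_zero.2 (S.ne_zero i))
  have hΛ : Λ = 0 := LinearMap.ext_on_range hS fun i => integral_laplacePoly_eq_zero h hy i
  have := LinearMap.congr_fun hΛ (X ^ l)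
  change ∫ x : USphere (k + 2), (((X ^ l : ℝ[X]).eval (inner ℝ x.1 y) : ℝ) : ℂ) * ψ x
    ∂(sphereMeasure (k + 2)) = 0 at this
  simpa using this

/-! ### Density of the exponentials of linear forms. -/

/-- The restriction of a real linear form to the sphere. -/
def linearFun (n : ℕ) (y : EuclideanSpace ℝ (Fin (n + 1))) : C(USphere n, ℂ) where
  toFun x := ((inner ℝ x.1 y : ℝ) : ℂ)
  continuous_toFun := by fun_prop

theorem linearFun_add (n : ℕ) (y z : EuclideanSpace ℝ (Fin (n + 1))) :
    linearFun n (y + z) = linearFun n y + linearFun n z := by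
  ext x
  simp [linearFun, inner_add_right]

/-- The exponentials of real linear forms, as a monoid homomorphism. -/
def expLinear (n : ℕ) : Multiplicative (EuclideanSpace ℝ (Fin (n + 1))) →* C(USphere n, ℂ) where
  toFun y := NormedSpace.exp (linearFun n y.toAdd)
  map_one' := by
    have : linearFun n 0 = 0 := by ext x; simp [linearFun]
    rw [toAdd_one, this, NormedSpace.exp_zero]
  map_mul' y z := by
    rw [toAdd_mul, linearFun_add, NormedSpace.exp_add_of_commute (Commute.all _ _)]

theorem expLinear_apply (n : ℕ) (y : EuclideanSpace ℝ (Fin (n + 1))) (x : USphere n) :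
    expLinear n (Multiplicative.ofAdd y) x = Complex.exp (inner ℝ x.1 y : ℝ) := by
  have h := ContinuousMap.hasSum_apply
    (NormedSpace.exp_series_hasSum_exp' (𝕂 := ℂ) (linearFun n y)) x
  have h2 := NormedSpace.exp_series_hasSum_exp' (𝕂 := ℂ) (((inner ℝ x.1 y : ℝ) : ℂ))
  rw [← Complex.exp_eq_exp_ℂ] at h2
  exact h.unique h2

/-- Stone–Weierstrass. The exponentials are closed under multiplication, so their span is already
the algebra that they generate; they are real-valued, and the exponential of `x ↦ x · (p - q)`
separates `p` from `q`. -/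
theorem span_expLinear_dense (n : ℕ) :
    (Submodule.span ℂ (MonoidHom.mrange (expLinear n) : Set C(USphere n, ℂ))).topologicalClosure
      = ⊤ := by
  set s : Set C(USphere n, ℂ) := (MonoidHom.mrange (expLinear n) : Set C(USphere n, ℂ)) with hs
  have hstar : ∀ f ∈ s, star f = f := by
    rintro _ ⟨y, rfl⟩
    ext x
    change conj (expLinear n (Multiplicative.ofAdd y.toAdd) x) = _
    rw [expLinear_apply, ← Complex.exp_conj, Complex.conj_ofReal, ← expLinear_apply]
    rfl
  let A : StarSubalgebra ℂ C(USphere n, ℂ) :=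
    { Algebra.adjoin ℂ s with
      star_mem' := fun {f} hf => by
        induction hf using Algebra.adjoin_induction with
        | mem f hf => rw [hstar f hf]; exact Algebra.subset_adjoin hf
        | algebraMap r =>
          rw [← algebraMap_star_comm]
          exact Subalgebra.algebraMap_mem _ _
        | add f g _ _ hf hg => rw [star_add]; exact Subalgebra.add_mem _ hf hg
        | mul f g _ _ hf hg => rw [star_mul']; exact Subalgebra.mul_mem _ hf hg }
  have hA : A.SeparatesPoints := by
    intro x x' hxx
    refine ⟨expLinear n (Multiplicative.ofAdd (x.1 - x'.1)),
      ⟨_, Algebra.subset_adjoin ⟨_, rfl⟩, rfl⟩, ?_⟩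
    rw [expLinear_apply, expLinear_apply, ← Complex.ofReal_exp, ← Complex.ofReal_exp, Ne,
      Complex.ofReal_inj, Real.exp_eq_exp]
    intro h
    have h0 : inner ℝ (x.1 - x'.1) (x.1 - x'.1) = (0 : ℝ) := by
      rw [inner_sub_left, h, sub_self]
    exact hxx (Subtype.ext (sub_eq_zero.1 (inner_self_eq_zero.1 h0)))
  have hd := ContinuousMap.starSubalgebra_topologicalClosure_eq_top_of_separatesPoints A hA
  have hspan : (Submodule.span ℂ s : Set C(USphere n, ℂ)) = (A : Set C(USphere n, ℂ)) := by
    have := Algebra.adjoin_eq_span ℂ s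
    rw [hs, Submonoid.closure_eq] at this
    rw [hs, ← this]
    rfl
  rw [eq_top_iff]
  intro f _
  rw [← SetLike.mem_coe, Submodule.topologicalClosure_coe, hspan, ← StarSubalgebra.topologicalClosure_coe,
    hd]
  trivial

theorem weaklyRegular_sphereMeasure (n : ℕ) : (sphereMeasure n).WeaklyRegular :=
  Measure.WeaklyRegular.of_pseudoMetrizableSpace_of_isFiniteMeasure _

theorem eq_zero_of_inner_powState_eq_zero {k : ℕ} {ψ : L2Sphere (k + 2)}
    (h : ∀ α : Fin (k + 2 + 1) → ℂ, α ⬝ᵥ α = 0 → ∀ l, inner ℂ (powState (k + 2) l α) ψ = 0) :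
    ψ = 0 := by
  set Λ : C(USphere (k + 2), ℂ) →L[ℂ] ℂ :=
    (innerSL ℂ ψ).comp (ContinuousMap.toLp 2 (sphereMeasure (k + 2)) ℂ) with hΛ
  have hpow : ∀ (y : EuclideanSpace ℝ (Fin (k + 2 + 1))) (l : ℕ),
      Λ (linearFun (k + 2) y ^ l) = 0 := by
    intro y l
    have hconj : ∀ f : C(USphere (k + 2), ℂ), (∀ x, conj (f x) = f x) →
        Λ f = conj (∫ x, f x * ψ x ∂(sphereMeasure (k + 2))) := by
      intro f hf
      rw [hΛ, ContinuousLinearMap.comp_apply, innerSL_apply_apply, ← inner_conj_symm, L2.inner_def]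
      congr 1
      refine integral_congr_ae ?_
      filter_upwards [ContinuousMap.coeFn_toLp (p := 2) (𝕜 := ℂ) (sphereMeasure (k + 2)) f]
        with x hx
      rw [hx, RCLike.inner_apply, hf, mul_comm]
    rw [hconj _ fun x => by
      change conj ((((inner ℝ x.1 y : ℝ) : ℂ)) ^ l) = ((inner ℝ x.1 y : ℝ) : ℂ) ^ l
      rw [map_pow, Complex.conj_ofReal]]
    change conj (∫ x : USphere (k + 2), ((inner ℝ x.1 y : ℝ) : ℂ) ^ l * ψ x
      ∂(sphereMeasure (k + 2))) = 0
    -- Homogeneity reduces to unit vectors; for `y = 0` any unit vector serves, with factor `0`.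
    obtain ⟨r, w, hw, rfl⟩ : ∃ (r : ℝ) (w : EuclideanSpace ℝ (Fin (k + 2 + 1))),
        ‖w‖ = 1 ∧ y = r • w := by
      by_cases hy : y = 0
      · refine ⟨0, EuclideanSpace.single 0 1, by simp, by simp [hy]⟩
      · exact ⟨‖y‖, ‖y‖⁻¹ • y, norm_smul_inv_norm hy,
          (smul_inv_smul₀ (norm_ne_zero_iff.2 hy) y).symm⟩
    simp only [real_inner_smul_right, Complex.ofReal_mul, mul_pow, mul_assoc]
    rw [integral_const_mul, integral_inner_pow_eq_zero h hw, mul_zero, map_zero]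
  have hexp : ∀ f ∈ (MonoidHom.mrange (expLinear (k + 2)) : Set C(USphere (k + 2), ℂ)),
      Λ f = 0 := by
    rintro _ ⟨y, rfl⟩
    have h1 := (NormedSpace.exp_series_hasSum_exp' (𝕂 := ℂ) (linearFun (k + 2) y.toAdd)).mapL Λ
    simp only [map_smul, hpow, smul_zero] at h1
    exact h1.unique hasSum_zero
  have hall : ∀ f, Λ f = 0 := by
    have hle : (Submodule.span ℂ (MonoidHom.mrange (expLinear (k + 2)) :
        Set C(USphere (k + 2), ℂ))).topologicalClosure ≤ LinearMap.ker Λ.toLinearMap :=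
      Submodule.topologicalClosure_minimal _ (Submodule.span_le.2 hexp) Λ.isClosed_ker
    rw [span_expLinear_dense] at hle
    exact fun f => hle trivial
  have := weaklyRegular_sphereMeasure (k + 2)
  have hdense := ContinuousMap.toLp_denseRange ℂ (sphereMeasure (k + 2)) (p := 2) ℂ (by simp)
  exact hdense.eq_zero_of_inner_left ℂ hall

/-! ### The transform attached to a parametrization of the isotropic cone -/

/-- A quadratic parametrization `ρ` of the cone of isotropic vectors in `ℂ^(k+3)`, together with
linear maps `G i`, `i = 0, …, k`, on the parameter space such that the fibres of `ρ` are preserved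
by `∑ᵢ vᵢ G i` for `v ∈ S^k`, and whose matrix coefficients have sum of squares `2 ρ(z) · ρ(w)`. -/
structure ConeModel {k m : ℕ} (ρ : (Fin m → ℂ) → Fin (k + 2 + 1) → ℂ)
    (G : Fin (k + 1) → (Fin m → ℂ) → Fin m → ℂ) : Prop where
  isotropic : ∀ z, ρ z ⬝ᵥ ρ z = 0
  surjective : ∀ α, α ⬝ᵥ α = 0 → ∃ z, ρ z = α
  differentiable : Differentiable ℂ ρ
  gram : ∀ z w, ∑ i, (∑ j, G i z j * conj (w j)) ^ 2 = 2 * (ρ z ⬝ᵥ star (ρ w))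
  invariant : ∀ (v : USphere k) (z), ρ (∑ i, (v.1 i : ℂ) • G i z) = ρ z

/-- Invariance of a function under the maps `∑ᵢ vᵢ G i`, `v ∈ S^k`. -/
def FibreInvariant {k m : ℕ} (G : Fin (k + 1) → (Fin m → ℂ) → Fin m → ℂ)
    (f : (Fin m → ℂ) → ℂ) : Prop :=
  ∀ (v : USphere k) (z), f (∑ i, (v.1 i : ℂ) • G i z) = f z

namespace ConeModel

variable {k m : ℕ} {ρ : (Fin m → ℂ) → Fin (k + 2 + 1) → ℂ}
  {G : Fin (k + 1) → (Fin m → ℂ) → Fin m → ℂ} {ħ : ℝ}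

theorem sum_smul_mul_conj (v : USphere k) (z w : Fin m → ℂ) :
    ∑ j, (∑ i, (v.1 i : ℂ) • G i z) j * conj (w j) =
      pairing v.1 fun i => ∑ j, G i z j * conj (w j) := by
  simp only [pairing, Finset.sum_apply, Pi.smul_apply, smul_eq_mul, Finset.sum_mul, Finset.mul_sum]
  rw [Finset.sum_comm]
  simp only [mul_assoc]

/-- The inner product of two coherent states is a spherical average of the exponential kernel. -/
theorem inner_coherentState (hM : ConeModel ρ G) (hħ : 0 < ħ) (z w : Fin m → ℂ) :
    inner ℂ (coherentState (k + 2) ħ (ρ z)) (coherentState (k + 2) ħ (ρ w)) =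
      ∫ v : USphere k, expKernel ħ (∑ i, (v.1 i : ℂ) • G i z) w ∂(sphereMeasure k) := by
  have h1 := hasSum_inner_coherentState k hħ (hM.isotropic z) (hM.isotropic w)
  have h2 := hasSum_integral_exp_pairing k (fun i => ∑ j, G i z j * conj (w j)) ħ
  simp only [expKernel, sum_smul_mul_conj]
  refine h1.unique (h2.congr_fun fun l => ?_)
  -- The `2` of the Gram identity cancels the `2 ^ l` in the denominators of the averaged
  -- exponential.
  have hd : (fun i => ∑ j, G i z j * conj (w j)) ⬝ᵥ (fun i => ∑ j, G i z j * conj (w j)) =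
      2 * (ρ z ⬝ᵥ star (ρ w)) := by
    rw [← hM.gram z w, dotProduct]
    exact Finset.sum_congr rfl fun i _ => (sq _).symm
  rw [hd, mul_pow, mul_assoc (2 ^ l : ℂ), mul_left_comm _ (2 ^ l : ℂ),
    mul_div_mul_left _ _ (pow_ne_zero l (two_ne_zero' ℂ))]

theorem norm_expKernel_orbit_le (hħ : 0 < ħ) (v : USphere k) (z w : Fin m → ℂ) :
    ‖expKernel ħ (∑ i, (v.1 i : ℂ) • G i z) w‖ ≤
      Real.exp ((∑ i, ∑ j, ‖G i z j‖) / ħ * ∑ j, ‖w j‖) := by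
  refine norm_expKernel_le hħ _ _ fun j => ?_
  rw [Finset.sum_apply]
  refine norm_sum_le_of_le _ fun i _ => ?_
  rw [Pi.smul_apply, norm_smul, Complex.norm_real]
  have h1 : ‖v.1 i‖ ≤ 1 := (PiLp.norm_apply_le v.1 i).trans (norm_coe_sphere v).le
  have h2 : ‖G i z j‖ ≤ ∑ j, ‖G i z j‖ :=
    Finset.single_le_sum (f := fun j => ‖G i z j‖) (fun _ _ => norm_nonneg _) (Finset.mem_univ j)
  nlinarith [norm_nonneg (G i z j)]

theorem continuous_expKernel_orbit (z : Fin m → ℂ) :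
    Continuous fun p : USphere k × (Fin m → ℂ) =>
      expKernel ħ (∑ i, (p.1.1 i : ℂ) • G i z) p.2 := by
  simp only [expKernel, sum_smul_mul_conj, pairing]
  fun_prop

/-- The reproducing property for invariant functions. -/
theorem reproducing (hM : ConeModel ρ G) (hħ : 0 < ħ) {f : (Fin m → ℂ) → ℂ}
    (hf : Differentiable ℂ f) (hL : MemLp f 2 (gaussMeasure m ħ)) (hG : FibreInvariant G f)
    (z : Fin m → ℂ) :
    ∫ w, inner ℂ (coherentState (k + 2) ħ (ρ z)) (coherentState (k + 2) ħ (ρ w)) * f w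
      ∂(gaussMeasure m ħ) = f z := by
  have := isProbabilityMeasure_gaussMeasure (m := m) hħ
  have hint : Integrable (Function.uncurry fun (v : USphere k) (w : Fin m → ℂ) =>
      expKernel ħ (∑ i, (v.1 i : ℂ) • G i z) w * f w)
      ((sphereMeasure k).prod (gaussMeasure m ħ)) := by
    have h1 : Integrable (fun w => Real.exp ((∑ i, ∑ j, ‖G i z j‖) / ħ * ∑ j, ‖w j‖) * ‖f w‖)
        (gaussMeasure m ħ) := (memLp_exp_gaussMeasure hħ _).integrable_mul hL.norm
    refine (h1.comp_snd (sphereMeasure k)).mono' ?_ (Filter.Eventually.of_forall fun p => ?_)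
    · exact ((continuous_expKernel_orbit z).mul
        (hf.continuous.comp continuous_snd)).aestronglyMeasurable
    · rw [Function.uncurry_def, norm_mul]
      exact mul_le_mul_of_nonneg_right (norm_expKernel_orbit_le hħ _ _ _) (norm_nonneg _)
  -- Integrating over `w` first gives `f` at the points of the orbit of `z`, where it equals `f z`;
  -- integrating over `v` first gives the coherent state kernel.
  have hswap := integral_integral_swap hint
  simp only [bargmann_reproducing hħ hf hL, hG _ z, integral_const, probReal_univ, one_smul,
    integral_mul_const, ← hM.inner_coherentState hħ] at hswap
  exact hswap.symm

/-- The transform of `ψ` is the function `z ↦ ⟨ψ, Φ_{ρ(z)}⟩`. -/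
def transformFun (ρ : (Fin m → ℂ) → Fin (k + 2 + 1) → ℂ) (ħ : ℝ) (ψ : L2Sphere (k + 2))
    (z : Fin m → ℂ) : ℂ :=
  inner ℂ (coherentState (k + 2) ħ (ρ z)) ψ

theorem differentiable_transformFun (hM : ConeModel ρ G) (ψ : L2Sphere (k + 2)) :
    Differentiable ℂ (transformFun ρ ħ ψ) := by
  have h : transformFun ρ ħ ψ = coneTransform (k + 2) ħ ψ ∘ ρ := by
    ext z
    exact (coneTransform_eq_inner _ _ _ _).symm
  rw [h]
  exact (differentiable_coneTransform _ _ _).comp hM.differentiable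

theorem fibreInvariant_transformFun (hM : ConeModel ρ G) (ψ : L2Sphere (k + 2)) :
    FibreInvariant G (transformFun ρ ħ ψ) := fun v z => by
  rw [transformFun, hM.invariant, transformFun]

/-- As an orbit average of exponential kernels, this transform grows at most exponentially in `z`.
In the averaging formula `w` takes the acted-on slot, leaving `z` as the free variable of the bound.
-/
theorem memLp_transformFun_coherentState (hM : ConeModel ρ G) (hħ : 0 < ħ) (w : Fin m → ℂ) :
    MemLp (transformFun ρ ħ (coherentState (k + 2) ħ (ρ w))) 2 (gaussMeasure m ħ) := by
  refine memLp_of_norm_le_exp hħ (hM.differentiable_transformFun _).continuous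
    ((∑ i, ∑ j, ‖G i w j‖) / ħ) fun z => ?_
  rw [transformFun, norm_inner_symm, hM.inner_coherentState hħ]
  refine (norm_integral_le_of_norm_le_const (Filter.Eventually.of_forall fun v =>
    norm_expKernel_orbit_le hħ v w z)).trans ?_
  simp

theorem inner_toLp_toLp {α : Type*} [MeasurableSpace α] {μ : Measure α} {f g : α → ℂ}
    (hf : MemLp f 2 μ) (hg : MemLp g 2 μ) :
    inner ℂ (hf.toLp f) (hg.toLp g) = ∫ a, conj (f a) * g a ∂μ := by
  rw [L2.inner_def]
  refine integral_congr_ae ?_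
  filter_upwards [hf.coeFn_toLp, hg.coeFn_toLp] with a h1 h2
  rw [h1, h2, RCLike.inner_apply, mul_comm]

theorem integral_conj_transformFun_coherentState (hM : ConeModel ρ G) (hħ : 0 < ħ)
    {f : (Fin m → ℂ) → ℂ} (hf : Differentiable ℂ f) (hL : MemLp f 2 (gaussMeasure m ħ))
    (hG : FibreInvariant G f) (w : Fin m → ℂ) :
    ∫ z, conj (transformFun ρ ħ (coherentState (k + 2) ħ (ρ w)) z) * f z ∂(gaussMeasure m ħ) =
      f w := by
  rw [← hM.reproducing hħ hf hL hG w]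
  simp only [transformFun, inner_conj_symm]

theorem transformFun_add (ψ η : L2Sphere (k + 2)) :
    transformFun ρ ħ (ψ + η) = transformFun ρ ħ ψ + transformFun ρ ħ η := by
  ext z
  exact inner_add_right _ _ _

theorem transformFun_smul (a : ℂ) (ψ : L2Sphere (k + 2)) :
    transformFun ρ ħ (a • ψ) = a • transformFun ρ ħ ψ := by
  ext z
  exact inner_smul_right _ _ _

/-- On a coherent state this is the reproducing property for the transform of `ψ`. Square
integrability of that transform is assumed because it is established for general `ψ` only through
the isometry on the span. -/
theorem isometry_on_span (hM : ConeModel ρ G) (hħ : 0 < ħ) {η : L2Sphere (k + 2)}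
    (hη : η ∈ Submodule.span ℂ (range fun w => coherentState (k + 2) ħ (ρ w))) :
    MemLp (transformFun ρ ħ η) 2 (gaussMeasure m ħ) ∧
      ∀ ψ, MemLp (transformFun ρ ħ ψ) 2 (gaussMeasure m ħ) →
        ∫ z, conj (transformFun ρ ħ η z) * transformFun ρ ħ ψ z ∂(gaussMeasure m ħ) =
          inner ℂ η ψ := by
  induction hη using Submodule.span_induction with
  | mem η h =>
    obtain ⟨w, rfl⟩ := h
    exact ⟨hM.memLp_transformFun_coherentState hħ w, fun ψ hψ =>
      hM.integral_conj_transformFun_coherentState hħ (hM.differentiable_transformFun ψ) hψ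
        (hM.fibreInvariant_transformFun ψ) w⟩
  | zero =>
    have h0 : transformFun ρ ħ (0 : L2Sphere (k + 2)) = 0 := by
      ext z; exact inner_zero_right _
    rw [h0]
    exact ⟨MemLp.zero, fun ψ _ => by simp⟩
  | add η χ _ _ h1 h2 =>
    rw [transformFun_add]
    refine ⟨h1.1.add h2.1, fun ψ hψ => ?_⟩
    rw [inner_add_left, ← h1.2 ψ hψ, ← h2.2 ψ hψ, ← integral_add]
    · simp [add_mul]
    · exact h1.1.star.integrable_mul hψ
    · exact h2.1.star.integrable_mul hψ
  | smul a η _ h1 =>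
    rw [transformFun_smul]
    refine ⟨h1.1.const_smul a, fun ψ hψ => ?_⟩
    rw [inner_smul_left, ← h1.2 ψ hψ, ← integral_const_mul]
    simp [mul_assoc]

theorem eLpNorm_transformFun_of_mem_span (hM : ConeModel ρ G) (hħ : 0 < ħ) {η : L2Sphere (k + 2)}
    (hη : η ∈ Submodule.span ℂ (range fun w => coherentState (k + 2) ħ (ρ w))) :
    eLpNorm (transformFun ρ ħ η) 2 (gaussMeasure m ħ) = ENNReal.ofReal ‖η‖ := by
  obtain ⟨h1, h2⟩ := hM.isometry_on_span hħ hη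
  have h3 := h2 η h1
  rw [← inner_toLp_toLp h1 h1, inner_self_eq_norm_sq_to_K, inner_self_eq_norm_sq_to_K] at h3
  have h4 : ‖h1.toLp _‖ ^ 2 = ‖η‖ ^ 2 := by exact_mod_cast h3
  have h5 : ‖h1.toLp _‖ = ‖η‖ := (sq_eq_sq₀ (norm_nonneg _) (norm_nonneg _)).1 h4
  rw [← h5, Lp.norm_toLp, ENNReal.ofReal_toReal h1.eLpNorm_ne_top]

/-- The cone is stable under complex scaling and `ρ` covers it, so orthogonality to all coherent
states passes to the powers of all isotropic forms. -/
theorem span_coherentState_dense (hM : ConeModel ρ G) (hħ : 0 < ħ) :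
    (Submodule.span ℂ (range fun w => coherentState (k + 2) ħ (ρ w))).topologicalClosure = ⊤ := by
  rw [Submodule.topologicalClosure_eq_top_iff, Submodule.eq_bot_iff]
  intro ψ hψ
  refine eq_zero_of_inner_powState_eq_zero fun α hα l => inner_powState_eq_zero hħ (fun t => ?_) l
  obtain ⟨z, hz⟩ := hM.surjective (t • α) (by simp [hα])
  rw [← hz]
  exact (Submodule.mem_orthogonal _ _).1 hψ _ (Submodule.subset_span (mem_range_self z))

theorem span_powState_dense (hM : ConeModel ρ G) :
    (Submodule.span ℂ (range fun p : ℕ × (Fin m → ℂ) =>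
      powState (k + 2) p.1 (ρ p.2))).topologicalClosure = ⊤ := by
  rw [Submodule.topologicalClosure_eq_top_iff, Submodule.eq_bot_iff]
  intro ψ hψ
  refine eq_zero_of_inner_powState_eq_zero fun α hα l => ?_
  obtain ⟨z, rfl⟩ := hM.surjective α hα
  exact (Submodule.mem_orthogonal _ _).1 hψ _ (Submodule.subset_span (mem_range_self (l, z)))

/-- Fatou's lemma: convergence in `L²(S^n)` forces pointwise convergence of the transforms, since
each value is an inner product with a fixed coherent state. -/
theorem eLpNorm_transformFun_le (hM : ConeModel ρ G) (hħ : 0 < ħ) (ψ : L2Sphere (k + 2)) :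
    eLpNorm (transformFun ρ ħ ψ) 2 (gaussMeasure m ħ) ≤ ENNReal.ofReal ‖ψ‖ := by
  have hψ : ψ ∈ closure (Submodule.span ℂ
      (range fun w => coherentState (k + 2) ħ (ρ w)) : Set (L2Sphere (k + 2))) := by
    rw [← Submodule.topologicalClosure_coe, hM.span_coherentState_dense hħ]
    trivial
  obtain ⟨u, hu, hlim⟩ := mem_closure_iff_seq_limit.1 hψ
  have h1 := Lp.eLpNorm_lim_le_liminf_eLpNorm (p := 2) (μ := gaussMeasure m ħ)
    (f := fun j => transformFun ρ ħ (u j))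
    (fun j => (hM.differentiable_transformFun _).continuous.aestronglyMeasurable)
    (transformFun ρ ħ ψ) (Filter.Eventually.of_forall fun z => by
      exact (tendsto_const_nhds.inner hlim))
  refine h1.trans (le_of_eq ?_)
  simp only [hM.eLpNorm_transformFun_of_mem_span hħ (hu _)]
  exact (ENNReal.tendsto_ofReal hlim.norm).liminf_eq

theorem memLp_transformFun (hM : ConeModel ρ G) (hħ : 0 < ħ) (ψ : L2Sphere (k + 2)) :
    MemLp (transformFun ρ ħ ψ) 2 (gaussMeasure m ħ) :=
  ⟨(hM.differentiable_transformFun _).continuous.aestronglyMeasurable,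
    (hM.eLpNorm_transformFun_le hħ ψ).trans_lt ENNReal.ofReal_lt_top⟩

theorem norm_bargmann_eq (f : Bargmann m ħ) :
    ‖f‖ = (eLpNorm (f : (Fin m → ℂ) → ℂ) 2 (gaussMeasure m ħ)).toReal :=
  Lp.norm_toLp _ f.memLp

/-- The transform as a linear map into the Bargmann space. -/
def transformLM (hM : ConeModel ρ G) (hħ : 0 < ħ) : L2Sphere (k + 2) →ₗ[ℂ] Bargmann m ħ where
  toFun ψ := ⟨transformFun ρ ħ ψ, hM.differentiable_transformFun ψ, hM.memLp_transformFun hħ ψ⟩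
  map_add' ψ η := Subtype.ext (transformFun_add ψ η)
  map_smul' a ψ := Subtype.ext (transformFun_smul a ψ)

theorem norm_transformLM_le (hM : ConeModel ρ G) (hħ : 0 < ħ) (ψ : L2Sphere (k + 2)) :
    ‖hM.transformLM hħ ψ‖ ≤ 1 * ‖ψ‖ := by
  rw [one_mul, norm_bargmann_eq]
  exact ENNReal.toReal_le_of_le_ofReal (norm_nonneg _) (hM.eLpNorm_transformFun_le hħ ψ)

theorem norm_transformLM (hM : ConeModel ρ G) (hħ : 0 < ħ) (ψ : L2Sphere (k + 2)) :
    ‖hM.transformLM hħ ψ‖ = ‖ψ‖ := by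
  set T := (hM.transformLM hħ).mkContinuous 1 (hM.norm_transformLM_le hħ) with hT
  -- The contraction bound makes equality of norms a closed condition, and it holds on a dense
  -- subspace.
  have hclosed : IsClosed {ψ | ‖T ψ‖ = ‖ψ‖} := isClosed_eq T.continuous.norm continuous_norm
  have hsub : (Submodule.span ℂ (range fun w => coherentState (k + 2) ħ (ρ w)) :
      Set (L2Sphere (k + 2))) ⊆ {ψ | ‖T ψ‖ = ‖ψ‖} := fun η hη => by
    change ‖hM.transformLM hħ η‖ = ‖η‖
    rw [norm_bargmann_eq]
    change (eLpNorm (transformFun ρ ħ η) 2 (gaussMeasure m ħ)).toReal = _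
    rw [hM.eLpNorm_transformFun_of_mem_span hħ hη, ENNReal.toReal_ofReal (norm_nonneg _)]
  have h := closure_minimal hsub hclosed
  rw [← Submodule.topologicalClosure_coe, hM.span_coherentState_dense hħ] at h
  exact h (mem_univ ψ)

/-- The transform as a linear isometry into the Bargmann space. -/
def transformLI (hM : ConeModel ρ G) (hħ : 0 < ħ) : L2Sphere (k + 2) →ₗᵢ[ℂ] Bargmann m ħ :=
  ⟨hM.transformLM hħ, hM.norm_transformLM hħ⟩

theorem transformLI_apply (hM : ConeModel ρ G) (hħ : 0 < ħ) (ψ : L2Sphere (k + 2))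
    (z : Fin m → ℂ) :
    hM.transformLI hħ ψ z = inner ℂ (coherentState (k + 2) ħ (ρ z)) ψ := rfl

/-- The transform as a linear isometry into `L²` of the Gaussian measure. -/
def transformL2 (hM : ConeModel ρ G) (hħ : 0 < ħ) :
    L2Sphere (k + 2) →ₗᵢ[ℂ] Lp ℂ 2 (gaussMeasure m ħ) :=
  ⟨(Bargmann.toL2 m ħ).comp (hM.transformLM hħ), hM.norm_transformLM hħ⟩

theorem integral_conj_transformFun (hM : ConeModel ρ G) (hħ : 0 < ħ) (η ψ : L2Sphere (k + 2)) :
    ∫ z, conj (transformFun ρ ħ η z) * transformFun ρ ħ ψ z ∂(gaussMeasure m ħ) =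
      inner ℂ η ψ := by
  rw [← inner_toLp_toLp (hM.memLp_transformFun hħ η) (hM.memLp_transformFun hħ ψ)]
  exact (hM.transformL2 hħ).inner_map_map η ψ

/-- The adjoint, taken in the full Gaussian `L²` space, supplies the preimage: testing it against
coherent states gives the reproducing integral of `f`. -/
theorem exists_transformLI_eq (hM : ConeModel ρ G) (hħ : 0 < ħ) {f : Bargmann m ħ}
    (hf : FibreInvariant G f) : ∃ ψ, hM.transformLI hħ ψ = f := by
  refine ⟨ContinuousLinearMap.adjoint (hM.transformL2 hħ).toContinuousLinearMap
    (Bargmann.toL2 m ħ f), Subtype.ext (funext fun z => ?_)⟩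
  change inner ℂ (coherentState (k + 2) ħ (ρ z)) (ContinuousLinearMap.adjoint
    (hM.transformL2 hħ).toContinuousLinearMap (Bargmann.toL2 m ħ f)) = f z
  rw [ContinuousLinearMap.adjoint_inner_right,
    ← hM.integral_conj_transformFun_coherentState hħ f.differentiable f.memLp hf z]
  exact inner_toLp_toLp (hM.memLp_transformFun hħ _) f.memLp

theorem fibreInvariant_transformLI (hM : ConeModel ρ G) (hħ : 0 < ħ) (ψ : L2Sphere (k + 2)) :
    FibreInvariant G (hM.transformLI hħ ψ) :=
  hM.fibreInvariant_transformFun ψ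

/-- The transform maps `L²(S^(k+2))` unitarily onto the space of invariant functions, and
intertwines a bounded operator with the integral operator that its kernel defines. -/
theorem exists_unitary (hM : ConeModel ρ G) (hħ : 0 < ħ) (F : Submodule ℂ (Bargmann m ħ))
    (hF : ∀ f : Bargmann m ħ, f ∈ F ↔ FibreInvariant G f) :
    ∃ B : L2Sphere (k + 2) ≃ₗᵢ[ℂ] F,
      (∀ (ψ : L2Sphere (k + 2)) (z : Fin m → ℂ),
        (B ψ : Bargmann m ħ) z = inner ℂ (coherentState (k + 2) ħ (ρ z)) ψ) ∧
      ∀ (A : L2Sphere (k + 2) →L[ℂ] L2Sphere (k + 2)) (f : F) (z : Fin m → ℂ),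
        Integrable (fun w => inner ℂ (coherentState (k + 2) ħ (ρ z))
          (A (coherentState (k + 2) ħ (ρ w))) * (f : Bargmann m ħ) w) (gaussMeasure m ħ) ∧
        ∫ w, inner ℂ (coherentState (k + 2) ħ (ρ z)) (A (coherentState (k + 2) ħ (ρ w))) *
          (f : Bargmann m ħ) w ∂(gaussMeasure m ħ) = (B (A (B.symm f)) : Bargmann m ħ) z := by
  let B₀ : L2Sphere (k + 2) →ₗᵢ[ℂ] F :=
    ⟨(hM.transformLM hħ).codRestrict F fun ψ => (hF _).2 (hM.fibreInvariant_transformLI hħ ψ),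
      hM.norm_transformLM hħ⟩
  have hsurj : Function.Surjective B₀ := fun f => by
    obtain ⟨ψ, hψ⟩ := hM.exists_transformLI_eq hħ ((hF f).1 f.2)
    exact ⟨ψ, Subtype.ext hψ⟩
  let B : L2Sphere (k + 2) ≃ₗᵢ[ℂ] F :=
    ⟨LinearEquiv.ofBijective B₀.toLinearMap ⟨B₀.injective, hsurj⟩, B₀.norm_map⟩
  have hB : ∀ (ψ : L2Sphere (k + 2)) (z : Fin m → ℂ),
      (B ψ : Bargmann m ħ) z = inner ℂ (coherentState (k + 2) ħ (ρ z)) ψ := fun ψ z => rfl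
  refine ⟨B, hB, fun A f z => ?_⟩
  obtain ⟨ψ, rfl⟩ := B.surjective f
  -- Moving `A` to the left slot writes the integrand as a product of two square integrable
  -- transforms, and the isometry evaluates its integral.
  set η := ContinuousLinearMap.adjoint A (coherentState (k + 2) ħ (ρ z)) with hη
  have h1 : ∀ w, inner ℂ (coherentState (k + 2) ħ (ρ z)) (A (coherentState (k + 2) ħ (ρ w))) *
      (B ψ : Bargmann m ħ) w = conj (transformFun ρ ħ η w) * transformFun ρ ħ ψ w := by
    intro w
    rw [← ContinuousLinearMap.adjoint_inner_left, ← hη, hB, transformFun, inner_conj_symm,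
      transformFun]
  simp only [h1]
  refine ⟨(hM.memLp_transformFun hħ η).star.integrable_mul (hM.memLp_transformFun hħ ψ), ?_⟩
  rw [hM.integral_conj_transformFun hħ, B.symm_apply_apply, hB, hη,
    ContinuousLinearMap.adjoint_inner_left]

end ConeModel

/-! ### Invariance and first order operators -/

theorem firstOrderOp_eq_fderiv {m : ℕ} (a : (Fin m → ℂ) → Fin m → ℂ) (f : (Fin m → ℂ) → ℂ)
    (v : Fin m → ℂ) : firstOrderOp a f v = fderiv ℂ f v (a v) := by
  conv_rhs => rw [pi_eq_sum_univ' (a v), map_sum]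
  simp only [firstOrderOp, map_smul, smul_eq_mul]

theorem hasDerivAt_comp_rotation {m : ℕ} {f : (Fin m → ℂ) → ℂ} (hf : Differentiable ℂ f)
    (z u : Fin m → ℂ) (θ : ℝ) :
    HasDerivAt (fun θ : ℝ => f ((Real.cos θ : ℂ) • z + (Real.sin θ : ℂ) • u))
      (fderiv ℂ f ((Real.cos θ : ℂ) • z + (Real.sin θ : ℂ) • u)
        ((-Real.sin θ : ℂ) • z + (Real.cos θ : ℂ) • u)) θ := by
  have h1 : HasDerivAt (fun θ : ℝ => (Real.cos θ : ℂ) • z + (Real.sin θ : ℂ) • u)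
      ((-Real.sin θ : ℂ) • z + (Real.cos θ : ℂ) • u) θ := by
    have hc := (Real.hasDerivAt_cos θ).ofReal_comp
    have hs := (Real.hasDerivAt_sin θ).ofReal_comp
    rw [Complex.ofReal_neg] at hc
    exact (hc.smul_const z).add (hs.smul_const u)
  exact ((hf _).hasFDerivAt.restrictScalars ℝ).comp_hasDerivAt θ h1

theorem exists_polar_of_mem_sphere {k : ℕ} (v : USphere (k + 1)) :
    ∃ (θ : ℝ) (y : Fin (k + 1) → ℝ), ∑ i, y i ^ 2 = 1 ∧ v.1 0 = Real.cos θ ∧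
      ∀ i : Fin (k + 1), v.1 i.succ = Real.sin θ * y i := by
  have hv : v.1 0 ^ 2 + ∑ i : Fin (k + 1), v.1 i.succ ^ 2 = 1 := by
    have := EuclideanSpace.norm_sq_eq v.1
    rw [norm_coe_sphere, Fin.sum_univ_succ] at this
    simpa using this.symm
  set s := ∑ i : Fin (k + 1), v.1 i.succ ^ 2 with hs
  have hs0 : 0 ≤ s := Finset.sum_nonneg fun i _ => sq_nonneg _
  obtain ⟨y, hy1, hy2⟩ : ∃ y : Fin (k + 1) → ℝ, ∑ i, y i ^ 2 = 1 ∧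
      ∀ i : Fin (k + 1), v.1 i.succ = √s * y i := by
    -- At the poles `sin θ` vanishes, so the direction `y` is arbitrary.
    by_cases h : s = 0
    · refine ⟨Pi.single 0 1, ?_, fun i => ?_⟩
      · rw [Finset.sum_eq_single 0 (fun i _ hi => by simp [hi]) (by simp)]
        simp
      · have := (Finset.sum_eq_zero_iff_of_nonneg fun i _ => sq_nonneg _).1 h i (Finset.mem_univ i)
        rw [h, Real.sqrt_zero, zero_mul]
        exact pow_eq_zero_iff two_ne_zero |>.1 this
    · have h1 : √s ≠ 0 := (Real.sqrt_pos.2 (lt_of_le_of_ne hs0 (Ne.symm h))).ne'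
      refine ⟨fun i => v.1 i.succ / √s, ?_, fun i => by field_simp⟩
      simp only [div_pow, Real.sq_sqrt hs0]
      rw [← Finset.sum_div, ← hs, div_self h]
  have hn : ‖(⟨v.1 0, √s⟩ : ℂ)‖ = 1 := by
    rw [← sq_eq_sq₀ (norm_nonneg _) zero_le_one, Complex.sq_norm, Complex.normSq_mk, one_pow,
      Real.mul_self_sqrt hs0, ← sq, hv]
  refine ⟨Complex.arg ⟨v.1 0, √s⟩, y, hy1, ?_, fun i => ?_⟩
  · have := Complex.norm_mul_cos_arg ⟨v.1 0, √s⟩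
    rw [hn, one_mul] at this
    exact this.symm
  · have := Complex.norm_mul_sin_arg ⟨v.1 0, √s⟩
    rw [hn, one_mul] at this
    rw [this]
    exact hy2 i

/-- If the unit combinations of the linear vector fields `L 1, L 2, …` are complex structures,
then invariance under all `v₀ + ∑ᵢ vᵢ L i`, `v` in the sphere, is annihilation by the fields. -/
theorem fibreInvariant_iff {k m : ℕ} {f : (Fin m → ℂ) → ℂ} (hf : Differentiable ℂ f)
    {L : Fin (k + 1 + 1) → (Fin m → ℂ) → Fin m → ℂ} (h0 : ∀ z, L 0 z = z)
    (hL : ∀ i (a b : ℂ) (z w), L i (a • z + b • w) = a • L i z + b • L i w)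
    (hsq : ∀ y : Fin (k + 1) → ℝ, ∑ i, y i ^ 2 = 1 → ∀ z,
      ∑ i, (y i : ℂ) • L i.succ (∑ j, (y j : ℂ) • L j.succ z) = -z) :
    FibreInvariant (k := k + 1) L f ↔ ∀ (i : Fin (k + 1)) (z), fderiv ℂ f z (L i.succ z) = 0 := by
  constructor
  · intro h i z
    -- The curve `cos θ z + sin θ L z` stays in the orbit of `z` and has velocity `L z` at `θ = 0`.
    have hd := hasDerivAt_comp_rotation hf z (L i.succ z) 0
    have hconst : (fun θ : ℝ => f ((Real.cos θ : ℂ) • z + (Real.sin θ : ℂ) • L i.succ z)) =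
        fun _ => f z := by
      ext θ
      let v : EuclideanSpace ℝ (Fin (k + 1 + 1)) :=
        WithLp.toLp 2 (Fin.cons (Real.cos θ) (Pi.single i (Real.sin θ)))
      have hv : v ∈ Metric.sphere (0 : EuclideanSpace ℝ (Fin (k + 1 + 1))) 1 := by
        rw [mem_sphere_zero_iff_norm, ← sq_eq_sq₀ (norm_nonneg _) zero_le_one,
          EuclideanSpace.norm_sq_eq, Fin.sum_univ_succ,
          Finset.sum_eq_single i (fun j _ hj => by simp [v, hj]) (by simp)]
        simp [v]
      rw [← h ⟨v, hv⟩ z, Fin.sum_univ_succ,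
        Finset.sum_eq_single i (fun j _ hj => by simp [v, hj]) (by simp)]
      simp [v, h0]
    rw [hconst] at hd
    have := hd.unique (hasDerivAt_const _ _)
    simpa using this
  · intro h v z
    obtain ⟨θ, y, hy, hv0, hvs⟩ := exists_polar_of_mem_sphere v
    set Y : (Fin m → ℂ) → Fin m → ℂ := fun z => ∑ i, (y i : ℂ) • L i.succ z with hY
    have hYlin : ∀ (a b : ℂ) (z w), Y (a • z + b • w) = a • Y z + b • Y w := by
      intro a b z w
      simp only [hY, hL, smul_add, Finset.sum_add_distrib, Finset.smul_sum, smul_comm a,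
        smul_comm b]
    have hYY : Y (Y z) = -z := hsq y hy z
    have hYf : ∀ w, fderiv ℂ f w (Y w) = 0 := by
      intro w
      simp only [hY, map_sum, map_smul, h, smul_zero, Finset.sum_const_zero]
    -- Since `Y² = -1`, the velocity of the curve at each time is `Y` of its position, so `f` is
    -- constant along it.
    have hderiv : ∀ θ : ℝ, HasDerivAt
        (fun θ : ℝ => f ((Real.cos θ : ℂ) • z + (Real.sin θ : ℂ) • Y z)) 0 θ := by
      intro θ
      have hd := hasDerivAt_comp_rotation hf z (Y z) θ
      have h1 := hYf ((Real.cos θ : ℂ) • z + (Real.sin θ : ℂ) • Y z)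
      rw [hYlin, hYY] at h1
      rwa [show (-Real.sin θ : ℂ) • z + (Real.cos θ : ℂ) • Y z =
        (Real.cos θ : ℂ) • Y z + (Real.sin θ : ℂ) • -z by module, h1] at hd
    have hc := is_const_of_deriv_eq_zero (fun θ => (hderiv θ).differentiableAt)
      (fun θ => (hderiv θ).deriv) θ 0
    simp only [Real.cos_zero, Real.sin_zero, Complex.ofReal_one, Complex.ofReal_zero, one_smul,
      zero_smul, add_zero] at hc
    rw [← hc, Fin.sum_univ_succ, h0, hv0]
    congr 2
    simp only [hvs, hY, Finset.smul_sum, smul_smul]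
    push_cast
    rfl

/-! ### The case `(n, m) = (2, 2)` -/

/-- Here `S^0 = {±1}` acts by sign, and the Gram identity says that `2 ρ(z) · ρ(w)` is the square of
`z · w`. -/
theorem coneModel22 : ConeModel (k := 0) rho22 fun _ z => z where
  isotropic z := by
    simp [rho22, dotProduct, Fin.sum_univ_succ]
    linear_combination (1 / 4 * (z 0 ^ 2 + z 1 ^ 2) ^ 2) * Complex.I_sq
  surjective α hα := by
    have h : α 0 ^ 2 + α 1 ^ 2 + α 2 ^ 2 = 0 := by
      rw [← hα]; simp [dotProduct, Fin.sum_univ_succ]; ring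
    -- The first two coordinates determine `z 0 ^ 2` and `z 1 ^ 2`; the isotropy relation gives `p q
    -- = ± α 2`, and the sign of `p` is adjusted.
    obtain ⟨p, hp⟩ := IsAlgClosed.exists_eq_mul_self (-α 0 - Complex.I * α 1)
    obtain ⟨q, hq⟩ := IsAlgClosed.exists_eq_mul_self (α 0 - Complex.I * α 1)
    have hpq : (p * q - α 2) * (p * q + α 2) = 0 := by
      have h1 : (p * q) ^ 2 = (-α 0 - Complex.I * α 1) * (α 0 - Complex.I * α 1) := by
        rw [hp, hq]; ring
      linear_combination h1 + α 1 ^ 2 * Complex.I_sq - h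
    have key : ∀ p' : ℂ, -α 0 - Complex.I * α 1 = p' * p' → p' * q = α 2 →
        rho22 ![p', q] = α := by
      intro p' h1 h2
      ext j
      fin_cases j
      · simp [rho22]
        linear_combination (1 / 2) * h1 - (1 / 2) * hq
      · simp [rho22]
        linear_combination (-(Complex.I) / 2) * h1 - (Complex.I / 2) * hq - α 1 * Complex.I_sq
      · simpa [rho22] using h2
    rcases mul_eq_zero.1 hpq with h1 | h1
    · exact ⟨_, key p hp (sub_eq_zero.1 h1)⟩
    · exact ⟨_, key (-p) (by rw [hp]; ring) (by linear_combination -h1)⟩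
  differentiable := by
    rw [differentiable_pi]
    intro j
    fin_cases j <;> simp [rho22] <;> fun_prop
  gram z w := by
    simp [rho22, dotProduct, Fin.sum_univ_succ, map_ofNat]
    ring_nf
    simp [Complex.I_sq]
    ring
  invariant v z := by
    have hv : (v.1 0 : ℂ) ^ 2 = 1 := by
      have := EuclideanSpace.norm_sq_eq v.1
      rw [norm_coe_sphere] at this
      simp at this
      exact_mod_cast this.symm
    ext j
    fin_cases j <;> simp [rho22, mul_pow, hv]
    linear_combination z 0 * z 1 * hv

/-! ### The case `(n, m) = (3, 4)` -/

/-- The linear maps whose unit combinations preserve the fibres of `rho34`. -/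
def fibreMaps34 : Fin 2 → (Fin 4 → ℂ) → Fin 4 → ℂ :=
  ![fun z => z, fun z => ![Complex.I * z 0, Complex.I * z 1, -(Complex.I * z 2), -(Complex.I * z 3)]]

theorem rho34_scale (z : Fin 4 → ℂ) {a b : ℂ} (h : a * b = 1) :
    rho34 ![a * z 0, a * z 1, b * z 2, b * z 3] = rho34 z := by
  ext j
  fin_cases j <;> simp [rho34]
  · linear_combination (z 0 * z 2 + z 1 * z 3) * h
  · linear_combination (z 0 * z 2 - z 1 * z 3) * h
  · linear_combination (z 0 * z 3 + z 1 * z 2) * h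
  · linear_combination (z 0 * z 3 - z 1 * z 2) * h

/-- A `2 × 2` matrix of determinant zero is a column times a row: here with rows `(a, c)` and `(d,
b)`. -/
theorem exists_products_eq {a b c d : ℂ} (h : a * b = c * d) :
    ∃ z : Fin 4 → ℂ, z 0 * z 2 = a ∧ z 1 * z 3 = b ∧ z 0 * z 3 = c ∧ z 1 * z 2 = d := by
  by_cases ha : a = 0
  · by_cases hc : c = 0
    · exact ⟨![0, 1, d, b], by simp [ha, hc]⟩
    · refine ⟨![1, b / c, a, c], by simp, by simp [hc], by simp, ?_⟩
      simp
      field_simp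
      linear_combination h
  · refine ⟨![1, d / a, a, c], by simp, ?_, by simp, by simp [ha]⟩
    simp
    field_simp
    linear_combination -h

/-- The circle acts by `v₀ + i v₁` on the first pair of coordinates and by its inverse on the
second; `ρ` is linear in the products across the pairs. In these products isotropy is the vanishing
of a determinant. -/
theorem coneModel34 : ConeModel (k := 1) rho34 fibreMaps34 where
  isotropic z := by
    simp [rho34, dotProduct, Fin.sum_univ_succ]
    linear_combination ((z 0 * z 2 - z 1 * z 3) ^ 2 + (z 0 * z 3 + z 1 * z 2) ^ 2) * Complex.I_sq
  surjective α hα := by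
    have h : α 0 ^ 2 + α 1 ^ 2 + α 2 ^ 2 + α 3 ^ 2 = 0 := by
      rw [← hα]; simp [dotProduct, Fin.sum_univ_succ]; ring
    obtain ⟨z, h1, h2, h3, h4⟩ := exists_products_eq (a := (α 0 - Complex.I * α 1) / 2)
      (b := (α 0 + Complex.I * α 1) / 2) (c := (α 3 - Complex.I * α 2) / 2)
      (d := (-α 3 - Complex.I * α 2) / 2)
      (by linear_combination (1 / 4) * h - (1 / 4) * (α 1 ^ 2 + α 2 ^ 2) * Complex.I_sq)
    refine ⟨z, ?_⟩
    ext j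
    fin_cases j <;> simp [rho34, h1, h2, h3, h4]
    · ring
    · linear_combination (-α 1) * Complex.I_sq
    · linear_combination (-α 2) * Complex.I_sq
    · ring
  differentiable := by
    rw [differentiable_pi]
    intro j
    fin_cases j <;> simp [rho34] <;> fun_prop
  gram z w := by
    simp [rho34, fibreMaps34, dotProduct, Fin.sum_univ_succ]
    ring_nf
    simp [Complex.I_sq]
  invariant v z := by
    have hv : (v.1 0 : ℂ) ^ 2 + (v.1 1 : ℂ) ^ 2 = 1 := by
      have := EuclideanSpace.norm_sq_eq v.1
      rw [norm_coe_sphere] at this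
      simp [Fin.sum_univ_succ] at this
      exact_mod_cast this.symm
    rw [← rho34_scale z (a := v.1 0 + Complex.I * v.1 1) (b := v.1 0 - Complex.I * v.1 1)
      (by linear_combination hv - (v.1 1 : ℂ) ^ 2 * Complex.I_sq)]
    congr 1
    ext j
    fin_cases j <;> simp [fibreMaps34, Fin.sum_univ_succ] <;> ring

theorem mem_F4_iff {ħ : ℝ} (f : Bargmann 4 ħ) :
    f ∈ F4 ħ ↔ FibreInvariant (k := 1) fibreMaps34 f := by
  rw [fibreInvariant_iff (k := 0) f.differentiable]
  · change (∀ v, firstOrderOp _ f v = 0) ↔ _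
    simp only [firstOrderOp_eq_fderiv]
    have h : ∀ v : Fin 4 → ℂ, fibreMaps34 1 v = Complex.I • ![v 0, v 1, -v 2, -v 3] := by
      intro v
      ext j
      fin_cases j <;> simp [fibreMaps34]
    refine ⟨fun hf i z => ?_, fun hf z => ?_⟩
    · obtain rfl : i = 0 := Fin.eq_zero i
      change fderiv ℂ _ z (fibreMaps34 1 z) = 0
      rw [h, map_smul, hf, smul_zero]
    · have h1 : fderiv ℂ (f : (Fin 4 → ℂ) → ℂ) z (fibreMaps34 1 z) = 0 := hf 0 z
      rw [h, map_smul, smul_eq_zero] at h1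
      exact h1.resolve_left Complex.I_ne_zero
  · intro z; rfl
  · intro i a b z w
    ext j
    fin_cases i <;> fin_cases j <;> simp [fibreMaps34] <;> ring
  · intro y hy z
    have hy' : (y 0 : ℂ) ^ 2 = 1 := by
      have : y 0 ^ 2 = 1 := by simpa using hy
      exact_mod_cast this
    ext j
    fin_cases j <;> simp [fibreMaps34]
    · linear_combination (-z 0) * hy' + (y 0 : ℂ) ^ 2 * z 0 * Complex.I_sq
    · linear_combination (-z 1) * hy' + (y 0 : ℂ) ^ 2 * z 1 * Complex.I_sq
    · linear_combination (-z 2) * hy' + (y 0 : ℂ) ^ 2 * z 2 * Complex.I_sq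
    · linear_combination (-z 3) * hy' + (y 0 : ℂ) ^ 2 * z 3 * Complex.I_sq

/-! ### The even subspace -/

/-- By the reproducing property, evaluation is an inner product with a fixed `L²` function.
Pointwise conditions such as evenness are therefore closed. -/
theorem continuous_bargmann_eval {m : ℕ} {ħ : ℝ} (hħ : 0 < ħ) (z : Fin m → ℂ) :
    Continuous fun f : Bargmann m ħ => f z := by
  have hK := memLp_expKernel (m := m) hħ z
  have h : ∀ f : Bargmann m ħ,
      f z = inner ℂ (hK.star.toLp (star (expKernel ħ z))) (Bargmann.toL2 m ħ f) := by
    intro f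
    rw [← bargmann_reproducing hħ f.differentiable f.memLp z]
    refine Eq.trans ?_ (ConeModel.inner_toLp_toLp hK.star f.memLp).symm
    simp
  simp only [h]
  have hc : Continuous (Bargmann.toL2 m ħ) :=
    (AddMonoidHomClass.isometry_of_norm (Bargmann.toL2 m ħ) fun _ => rfl).continuous
  exact continuous_const.inner hc

theorem memLp_monomial {m : ℕ} {ħ : ℝ} (hħ : 0 < ħ) (k : Fin m → ℕ) :
    MemLp (fun z : Fin m → ℂ => ∏ j, z j ^ k j) 2 (gaussMeasure m ħ) := by
  refine ((memLp_exp_gaussMeasure hħ 1).const_mul (∏ j, ((k j)! : ℝ))).mono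
    (Continuous.aestronglyMeasurable (by fun_prop)) (Filter.Eventually.of_forall fun z => ?_)
  rw [one_mul, Real.exp_sum, ← Finset.prod_mul_distrib, norm_prod, norm_prod]
  refine Finset.prod_le_prod (fun _ _ => norm_nonneg _) fun j _ => ?_
  rw [norm_pow, Real.norm_of_nonneg (by positivity)]
  have := Real.pow_div_factorial_le_exp ‖z j‖ (norm_nonneg _) (k j)
  rwa [div_le_iff₀' (by positivity)] at this

/-- The monomials as elements of the Bargmann space. -/
def bargmannMonomial {m : ℕ} {ħ : ℝ} (hħ : 0 < ħ) (k : Fin m → ℕ) : Bargmann m ħ :=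
  ⟨fun z => ∏ j, z j ^ k j, by fun_prop, memLp_monomial hħ k⟩

theorem bargmann_sum_apply {m : ℕ} {ħ : ℝ} {ι : Type*} (s : Finset ι) (f : ι → Bargmann m ħ)
    (z : Fin m → ℂ) : (∑ i ∈ s, f i : Bargmann m ħ) z = ∑ i ∈ s, f i z := by
  classical
  induction s using Finset.induction_on with
  | empty => simp
  | insert i s hi ih => rw [Finset.sum_insert hi, Finset.sum_insert hi, Bargmann.add_apply, ih]

theorem even_of_mem_F2 {ħ : ℝ} (hħ : 0 < ħ) {f : Bargmann 2 ħ} (hf : f ∈ F2 ħ)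
    (z : Fin 2 → ℂ) : f (-z) = f z := by
  let E : Submodule ℂ (Bargmann 2 ħ) :=
    { carrier := {f | ∀ z, f (-z) = f z}
      zero_mem' := fun z => rfl
      add_mem' := fun {f g} hf hg z => by
        rw [Bargmann.add_apply, Bargmann.add_apply, hf, hg]
      smul_mem' := fun c f hf z => by rw [Bargmann.smul_apply, Bargmann.smul_apply, hf] }
  have hE : IsClosed (E : Set (Bargmann 2 ħ)) := by
    have : (E : Set (Bargmann 2 ħ)) = ⋂ z, {f | f (-z) = f z} := by
      ext f
      rw [Set.mem_iInter]
      rfl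
    rw [this]
    exact isClosed_iInter fun z =>
      isClosed_eq (continuous_bargmann_eval hħ _) (continuous_bargmann_eval hħ _)
  have hle : F2 ħ ≤ E := by
    refine Submodule.topologicalClosure_minimal _ (Submodule.span_le.2 ?_) hE
    rintro f ⟨k, hk, hfk⟩ z
    rw [hfk, hfk]
    simp only [Fin.sum_univ_two] at hk
    simp only [Fin.prod_univ_two, Pi.neg_apply]
    rw [neg_pow (z 0), neg_pow (z 1), mul_mul_mul_comm, ← pow_add, hk.neg_one_pow, one_mul]
  exact hle hf z

theorem rho22_dotProduct_star (z w : Fin 2 → ℂ) :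
    rho22 z ⬝ᵥ star (rho22 w) = (1 / 2) * (z 0 * conj (w 0) + z 1 * conj (w 1)) ^ 2 := by
  have h := coneModel22.gram z w
  rw [Fin.sum_univ_one, Fin.sum_univ_two] at h
  linear_combination (-1 / 2) * h

/-- The transform is a multiple of `(z · w)^(2l)`, which the binomial theorem expands in monomials
of degree `2l`. -/
theorem transform_powState_mem_F2 {ħ : ℝ} (hħ : 0 < ħ) (l : ℕ) (w : Fin 2 → ℂ) :
    coneModel22.transformLI hħ (powState 2 l (rho22 w)) ∈ F2 ħ := by
  refine Submodule.le_topologicalClosure _ ?_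
  set a : ℂ := ((kernelCoeff 2 l / ħ ^ l : ℝ) : ℂ) *
    ((l ! : ℂ) * (1 / 2) ^ l / (stepTwoFactorial (2 + 1) l : ℂ)) with ha
  have h : coneModel22.transformLI hħ (powState 2 l (rho22 w)) =
      ∑ i ∈ Finset.range (2 * l + 1),
        (a * (conj (w 0) ^ i * conj (w 1) ^ (2 * l - i) * ((2 * l).choose i : ℂ))) •
          bargmannMonomial hħ ![i, 2 * l - i] := by
    refine Subtype.ext (funext fun z => ?_)
    refine Eq.trans ?_ (bargmann_sum_apply _ _ z).symm
    rw [coneModel22.transformLI_apply hħ]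
    refine (inner_coherentState_powState hħ (coneModel22.isotropic z)
      (coneModel22.isotropic w) l).trans ?_
    rw [rho22_dotProduct_star, mul_pow, ← pow_mul, add_pow]
    simp only [Finset.mul_sum, Finset.sum_div, ha]
    refine Finset.sum_congr rfl fun i _ => Eq.trans ?_ (Bargmann.smul_apply _ _ z).symm
    simp only [bargmannMonomial, Fin.prod_univ_two, Matrix.cons_val_zero, Matrix.cons_val_one,
      mul_pow]
    ring
  rw [h]
  refine Submodule.sum_mem _ fun i hi => Submodule.smul_mem _ _ (Submodule.subset_span ?_)
  refine ⟨![i, 2 * l - i], ?_, fun z => rfl⟩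
  have := Finset.mem_range.1 hi
  rw [Fin.sum_univ_two]
  exact ⟨l, by simp only [Matrix.cons_val_zero, Matrix.cons_val_one]; omega⟩

theorem mem_F2_iff {ħ : ℝ} (hħ : 0 < ħ) (f : Bargmann 2 ħ) :
    f ∈ F2 ħ ↔ FibreInvariant (k := 0) (fun _ z => z) f := by
  constructor
  · intro hf v z
    have hv : v.1 0 ^ 2 = 1 := by
      have := EuclideanSpace.norm_sq_eq v.1
      rw [norm_coe_sphere] at this
      simpa using this.symm
    rw [Fin.sum_univ_one]
    rcases sq_eq_sq_iff_eq_or_eq_neg.1 (hv.trans (one_pow 2).symm) with h | h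
    · simp [h]
    · simp [h, even_of_mem_F2 hħ hf]
  · intro hf
    -- Instead of expanding an even function in monomials, write it as a transform: the powers are
    -- dense in `L²(S²)` and their transforms lie in the closed space `F2`.
    obtain ⟨ψ, rfl⟩ := coneModel22.exists_transformLI_eq hħ hf
    have hle : (⊤ : Submodule ℂ (L2Sphere (0 + 2))) ≤
        (F2 ħ).comap (coneModel22.transformLI hħ).toLinearMap := by
      rw [← coneModel22.span_powState_dense]
      refine Submodule.topologicalClosure_minimal _ (Submodule.span_le.2 ?_) ?_
      · rintro _ ⟨p, rfl⟩
        exact transform_powState_mem_F2 hħ p.1 p.2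
      · exact (Submodule.isClosed_topologicalClosure _).preimage
          (coneModel22.transformLI hħ).continuous
    exact hle (mem_univ ψ)

/-! ### The case `(n, m) = (5, 8)` -/

/-- The linear maps whose unit combinations preserve the fibres of `rho58`. -/
def fibreMaps58 : Fin 4 → (Fin 8 → ℂ) → Fin 8 → ℂ :=
  ![fun z => z,
    fun z => Complex.I • ![z 0, z 1, z 2, z 3, -z 4, -z 5, -z 6, -z 7],
    fun z => ![z 6, -z 7, z 4, -z 5, -z 2, z 3, -z 0, z 1],
    fun z => Complex.I • ![z 6, -z 7, z 4, -z 5, z 2, -z 3, z 0, -z 1]]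

/-- The coordinates of `ρ` are combinations of the `2 × 2` minors of the matrix with columns `(z 0,
z 6)`, `(z 1, -z 7)`, `(z 2, z 4)`, `(z 3, -z 5)`. The substitution is left multiplication by a
matrix of determinant `a b + c d`. -/
theorem rho58_scale (z : Fin 8 → ℂ) {a b c d : ℂ} (h : a * b + c * d = 1) :
    rho58 ![a * z 0 + c * z 6, a * z 1 - c * z 7, a * z 2 + c * z 4, a * z 3 - c * z 5,
      b * z 4 - d * z 2, b * z 5 + d * z 3, b * z 6 - d * z 0, b * z 7 + d * z 1] = rho58 z := by
  ext j
  fin_cases j <;> simp [rho58]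
  · linear_combination (-(z 0 * z 5) + z 2 * z 7 + z 1 * z 4 - z 3 * z 6) * h
  · linear_combination (z 0 * z 5 + z 2 * z 7 + z 1 * z 4 + z 3 * z 6) * h
  · linear_combination (z 1 * z 5 + z 2 * z 6 - z 0 * z 4 - z 3 * z 7) * h
  · linear_combination (-(z 0 * z 4) + z 3 * z 7 - z 1 * z 5 + z 2 * z 6) * h
  · linear_combination (-(z 0 * z 7) - z 1 * z 6 - z 2 * z 5 - z 3 * z 4) * h
  · linear_combination (z 0 * z 7 + z 1 * z 6 - z 2 * z 5 - z 3 * z 4) * h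

/-- A solution of the Plücker relation is the vector of minors of a `2 × 4` matrix. -/
theorem exists_minors_eq {a b c d e f : ℂ} (h : a * f - b * e + c * d = 0) :
    ∃ u w : Fin 4 → ℂ, u 0 * w 1 - u 1 * w 0 = a ∧ u 0 * w 2 - u 2 * w 0 = b ∧
      u 0 * w 3 - u 3 * w 0 = c ∧ u 1 * w 2 - u 2 * w 1 = d ∧ u 1 * w 3 - u 3 * w 1 = e ∧
      u 2 * w 3 - u 3 * w 2 = f := by
  -- Choose a nonzero minor, bring its columns to `(1, 0)` and `(0, minor)`, and read off the other
  -- entries; the Plücker relation gives the minor that is left.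
  by_cases ha : a = 0
  · by_cases hb : b = 0
    · by_cases hc : c = 0
      · by_cases hd : d = 0
        · by_cases he : e = 0
          · exact ⟨![0, 0, 1, 0], ![0, 0, 0, f], by simp [ha, hb, hc, hd, he]⟩
          · exact ⟨![0, 1, f / e, 0], ![0, 0, 0, e], by simp [ha, hb, hc, hd, he]⟩
        · exact ⟨![0, 1, 0, -f / d], ![0, 0, d, e], by simp [ha, hb, hc, hd]⟩
      · obtain rfl : d = 0 := by
          have : c * d = 0 := by rw [ha, hb] at h; linear_combination h
          exact (mul_eq_zero.1 this).resolve_left hc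
        exact ⟨![1, e / c, f / c, 0], ![0, 0, 0, c], by simp [ha, hb, hc]⟩
    · refine ⟨![1, d / b, 0, -f / b], ![0, 0, b, c], by simp [ha], by simp, by simp,
        by simp [hb], ?_, by simp [hb]⟩
      simp
      field_simp
      rw [ha] at h
      linear_combination h
  · refine ⟨![1, 0, -d / a, -e / a], ![0, a, b, c], by simp, by simp, by simp, by simp [ha],
      by simp [ha], ?_⟩
    simp
    field_simp
    linear_combination -h

/-- `S^3` acts as `SU(2)` by left multiplication on a `2 × 4` matrix, and in terms of its minors
isotropy is the Plücker relation, which gives surjectivity. -/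
theorem coneModel58 : ConeModel (k := 3) rho58 fibreMaps58 where
  isotropic z := by
    simp [rho58, dotProduct, Fin.sum_univ_succ]
    ring_nf
    simp [Complex.I_sq]
    ring
  surjective α hα := by
    have h : α 0 ^ 2 + α 1 ^ 2 + α 2 ^ 2 + α 3 ^ 2 + α 4 ^ 2 + α 5 ^ 2 = 0 := by
      rw [← hα]; simp [dotProduct, Fin.sum_univ_succ]; ring
    obtain ⟨u, w, h1, h2, h3, h4, h5, h6⟩ := exists_minors_eq
      (a := (-α 5 - Complex.I * α 4) / 2) (b := (-α 2 + Complex.I * α 3) / 2)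
      (c := (-α 1 - Complex.I * α 0) / 2) (d := (α 1 - Complex.I * α 0) / 2)
      (e := (-α 2 - Complex.I * α 3) / 2) (f := (α 5 - Complex.I * α 4) / 2)
      (by linear_combination (-1 / 4) * h +
        (1 / 4) * (α 0 ^ 2 + α 3 ^ 2 + α 4 ^ 2) * Complex.I_sq)
    refine ⟨![u 0, u 1, u 2, u 3, w 2, -w 3, w 0, -w 1], ?_⟩
    ext j
    fin_cases j <;> simp [rho58]
    · linear_combination Complex.I * h3 + Complex.I * h4 - α 0 * Complex.I_sq
    · linear_combination h4 - h3
    · linear_combination -h5 - h2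
    · linear_combination Complex.I * h5 - Complex.I * h2 - α 3 * Complex.I_sq
    · linear_combination Complex.I * h1 + Complex.I * h6 - α 4 * Complex.I_sq
    · linear_combination h6 - h1
  differentiable := by
    rw [differentiable_pi]
    intro j
    fin_cases j <;> simp [rho58] <;> fun_prop
  gram z w := by
    simp [rho58, fibreMaps58, dotProduct, Fin.sum_univ_succ]
    ring_nf
    simp [Complex.I_sq]
  invariant v z := by
    have hv : (v.1 0 : ℂ) ^ 2 + (v.1 1 : ℂ) ^ 2 + (v.1 2 : ℂ) ^ 2 + (v.1 3 : ℂ) ^ 2 = 1 := by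
      have := EuclideanSpace.norm_sq_eq v.1
      rw [norm_coe_sphere] at this
      simp [Fin.sum_univ_succ] at this
      rw [add_assoc, add_assoc]
      exact_mod_cast this.symm
    rw [← rho58_scale z (a := v.1 0 + Complex.I * v.1 1) (b := v.1 0 - Complex.I * v.1 1)
      (c := v.1 2 + Complex.I * v.1 3) (d := v.1 2 - Complex.I * v.1 3)
      (by linear_combination hv - ((v.1 1 : ℂ) ^ 2 + (v.1 3 : ℂ) ^ 2) * Complex.I_sq)]
    congr 1
    ext j
    fin_cases j <;> simp [fibreMaps58, Fin.sum_univ_succ] <;> ring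

/-- The three generators are the fields defining `F8`, two of them up to the factor `i`, which does
not affect the kernel. They satisfy the quaternion relations, so every unit combination squares to
`-1`. -/
theorem mem_F8_iff {ħ : ℝ} (f : Bargmann 8 ħ) :
    f ∈ F8 ħ ↔ FibreInvariant (k := 3) fibreMaps58 f := by
  rw [fibreInvariant_iff (k := 2) f.differentiable]
  · change (((∀ v, firstOrderOp _ f v = 0) ∧ ∀ v, firstOrderOp _ f v = 0) ∧
      ∀ v, firstOrderOp _ f v = 0) ↔ _
    simp only [firstOrderOp_eq_fderiv]
    refine ⟨fun hf i z => ?_, fun hf => ⟨⟨fun z => ?_, fun z => hf 1 z⟩, fun z => ?_⟩⟩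
    · fin_cases i
      · change fderiv ℂ _ z (Complex.I • _) = 0
        rw [map_smul, hf.1.1, smul_zero]
      · exact hf.1.2 z
      · change fderiv ℂ _ z (Complex.I • _) = 0
        rw [map_smul, hf.2, smul_zero]
    · have h1 : fderiv ℂ (f : (Fin 8 → ℂ) → ℂ) z (Complex.I • _) = 0 := hf 0 z
      rw [map_smul, smul_eq_zero] at h1
      exact h1.resolve_left Complex.I_ne_zero
    · have h1 : fderiv ℂ (f : (Fin 8 → ℂ) → ℂ) z (Complex.I • _) = 0 := hf 2 z
      rw [map_smul, smul_eq_zero] at h1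
      exact h1.resolve_left Complex.I_ne_zero
  · intro z; rfl
  · intro i a b z w
    ext j
    fin_cases i <;> fin_cases j <;> simp [fibreMaps58] <;> ring
  · intro y hy z
    have hy' : (y 0 : ℂ) ^ 2 + (y 1 : ℂ) ^ 2 + (y 2 : ℂ) ^ 2 = 1 := by
      have : y 0 ^ 2 + y 1 ^ 2 + y 2 ^ 2 = 1 := by
        rw [← hy, Fin.sum_univ_three]
      exact_mod_cast this
    ext j
    fin_cases j <;> simp [fibreMaps58, Fin.sum_univ_succ]
    · linear_combination (-z 0) * hy' + ((y 0 : ℂ) ^ 2 + (y 2 : ℂ) ^ 2) * z 0 * Complex.I_sq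
    · linear_combination (-z 1) * hy' + ((y 0 : ℂ) ^ 2 + (y 2 : ℂ) ^ 2) * z 1 * Complex.I_sq
    · linear_combination (-z 2) * hy' + ((y 0 : ℂ) ^ 2 + (y 2 : ℂ) ^ 2) * z 2 * Complex.I_sq
    · linear_combination (-z 3) * hy' + ((y 0 : ℂ) ^ 2 + (y 2 : ℂ) ^ 2) * z 3 * Complex.I_sq
    · linear_combination (-z 4) * hy' + ((y 0 : ℂ) ^ 2 + (y 2 : ℂ) ^ 2) * z 4 * Complex.I_sq
    · linear_combination (-z 5) * hy' + ((y 0 : ℂ) ^ 2 + (y 2 : ℂ) ^ 2) * z 5 * Complex.I_sq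
    · linear_combination (-z 6) * hy' + ((y 0 : ℂ) ^ 2 + (y 2 : ℂ) ^ 2) * z 6 * Complex.I_sq
    · linear_combination (-z 7) * hy' + ((y 0 : ℂ) ^ 2 + (y 2 : ℂ) ^ 2) * z 7 * Complex.I_sq

/-! ### The three cases together -/

theorem transform_eq_inner (c : SphereCase) (ħ : ℝ) (ψ : L2Sphere c.n) (z : Fin c.m → ℂ) :
    c.transform ħ ψ z = inner ℂ (coherentState c.n ħ (c.rho z)) ψ := by
  rw [← coneTransform_eq_inner, SphereCase.transform, coneTransform]
  simp only [pairing, mul_comm]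

end

theorem mainTheorem8 (c : SphereCase) (ħ : ℝ) (hħ : 0 < ħ) :
    ∃ B : L2Sphere c.n ≃ₗᵢ[ℂ] c.F ħ,
      (∀ (ψ : L2Sphere c.n) (z : Fin c.m → ℂ),
        (B ψ : Bargmann c.m ħ) z = c.transform ħ ψ z) ∧
      ∀ (A : L2Sphere c.n →L[ℂ] L2Sphere c.n) (f : c.F ħ) (z : Fin c.m → ℂ),
        Integrable (fun w => c.kernelK ħ A z w * (f : Bargmann c.m ħ) w) (gaussMeasure c.m ħ) ∧
        c.sharp ħ A (f : Bargmann c.m ħ) z = (B (A (B.symm f)) : Bargmann c.m ħ) z := by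
  simp only [transform_eq_inner]
  match c with
  | .case22 => exact coneModel22.exists_unitary hħ (F2 ħ) (mem_F2_iff hħ)
  | .case34 => exact coneModel34.exists_unitary hħ (F4 ħ) mem_F4_iff
  | .case58 => exact coneModel58.exists_unitary hħ (F8 ħ) mem_F8_iff
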